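/- Let $V$ be a finite-dimensional real vector space, $g$ a non-degenerate symmetric bilinear form on $V$ (of any signature), and $L:V\to V$ a $g$-symmetric operator, i.e. $g(Lu,v)=g(u,Lv)$. Let $\mathrm{so}(g)=\{X\in\mathrm{gl}(V) : g(Xv,u)=-g(v,Xu)\}$ and let $\mathfrak g_L=\{X\in\mathrm{so}(g) : XL-LX=0\}$ be the centraliser of $L$ in $\mathrm{so}(g)$. Identify $\Lambda^2V\simeq\mathrm{so}(g)$ by $u\wedge v\mapsto u\otimes g(v)-v\otimes g(u)$, i.e. $u\wedge v$ acts as $w\mapsto g(v,w)u-g(u,w)v$. A linear map $R:\Lambda^2V\to\mathrm{gl}(V)$ is a \emph{formal curvature tensor} if $R(u\wedge v)w+R(v\wedge w)u+R(w\wedge u)v=0$ for all $u,v,w\in V$. A Lie subalgebra $\mathfrak h\subset\mathrm{gl}(V)$ is a \emph{Berger algebra} if it is spanned, as a vector space, by the operators $R(u\wedge v)$, where $u,v\in V$ and $R$ runs over the formal curvature tensors with image contained in $\mathfrak h$. Then $V$ has a $g$-orthogonal decomposition $V=V_1\oplus\dots\oplus V_k$ into $L$-invariant subspaces such that each $L_i=L|_{V_i}$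 is, in a suitable basis of $V_i$, a single real Jordan block (a Jordan block with a real eigenvalue, or a real Jordan block of even size with a pair of non-real complex conjugate eigenvalues). For any such decomposition and $i<j$, let $L_{ij}=L|_{V_i\oplus V_j}$, let $p_{ij}$ be the minimal polynomial of $L_{ij}$, and for $X\in\mathrm{so}(g)$ let $X_{(ij)}$ be the operator on $V_i\oplus V_j$ obtained by restricting $X$ to $V_i\oplus V_j$ and projecting back to $V_i\oplus V_j$ along the other blocks. Let $\widehat R_{ij}(X)$ be the operator on $V$ that equals $$\frac{d}{dt}\Big|_{t=0}p_{ij}\bigl(L_{ij}+tX_{(ij)}\bigr)$$ on $V_i\oplus V_j$ and vanishes on all other blocks, and put $R_{\mathrm{formal}}=\sum_{i<j}\widehat R_{ij}$. For every such decomposition, $R_{\mathrm{formal}}:\Lambda^2V\simeq\mathrm{so}(g)\to\mathrm{gl}(V)$ is a formal curvature tensor and its image is exactly $\mathfrak g_L$. In particular, $\mathfrak g_L$ is a Berger algebra. -/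

import Mathlib

attribute [local instance 100] LieRing.ofAssociativeRing

namespace JordanCurvature

open LinearMap (BilinForm)

/-! ### Formal curvature tensors and Berger algebras -/

section Berger

variable {V : Type*} [AddCommGroup V] [Module ℝ V]

/-- The bivector `u ∧ v` in `Λ²V`. -/
noncomputable def wedge (u v : V) : ⋀[ℝ]^2 V := exteriorPower.ιMulti ℝ 2 ![u, v]

/-- A linear map `R : Λ²V → gl(V)` is a formal curvature tensor if it satisfies the Bianchi
identity. -/
def IsFormalCurvatureTensor (R : ⋀[ℝ]^2 V →ₗ[ℝ] Module.End ℝ V) : Prop :=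
  ∀ u v w : V, R (wedge u v) w + R (wedge v w) u + R (wedge w u) v = 0

/-- A Lie subalgebra `h ⊆ gl(V)` is a Berger algebra if it is spanned, as a vector space, by the
operators `R (u ∧ v)`, where `R` runs through the formal curvature tensors with image in `h`. -/
def IsBergerAlgebra (h : LieSubalgebra ℝ (Module.End ℝ V)) : Prop :=
  h.toSubmodule = Submodule.span ℝ
    {A | ∃ R : ⋀[ℝ]^2 V →ₗ[ℝ] Module.End ℝ V, IsFormalCurvatureTensor R ∧
      LinearMap.range R ≤ h.toSubmodule ∧ ∃ u v : V, A = R (wedge u v)}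

end Berger

/-! ### The Lie algebras `so(g)` and `g_L`, and the identification of `Λ²V` with `so(g)` -/

section So

variable {V : Type*} [AddCommGroup V] [Module ℝ V]

/-- The Lie algebra `so(g)` of `g`-skew-symmetric operators. -/
def so (g : BilinForm ℝ V) : LieSubalgebra ℝ (Module.End ℝ V) where
  carrier := {X | ∀ u v : V, g (X v) u = -g v (X u)}
  zero_mem' := by simp
  add_mem' := by
    intro X Y hX hY u v
    simp [hX u v, hY u v]
    ring
  smul_mem' := by
    intro c X hX u v
    simp [hX u v]
  lie_mem' := by
    intro X Y hX hY u v
    simp only [LieRing.of_associative_ring_bracket, LinearMap.sub_apply, Module.End.mul_apply,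
      map_sub]
    rw [hX u (Y v), hY u (X v), hY (X u) v, hX (Y u) v]
    ring

/-- The centraliser `g_L` of `L` in `so(g)`. -/
def centraliserSo (g : BilinForm ℝ V) (L : Module.End ℝ V) :
    LieSubalgebra ℝ (Module.End ℝ V) where
  carrier := {X | X ∈ so g ∧ X * L - L * X = 0}
  zero_mem' := by simp
  add_mem' := by
    rintro X Y ⟨hX, hX'⟩ ⟨hY, hY'⟩
    refine ⟨add_mem hX hY, ?_⟩
    rw [sub_eq_zero] at *
    rw [add_mul, mul_add, hX', hY']
  smul_mem' := by
    rintro c X ⟨hX, hX'⟩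
    refine ⟨(so g).smul_mem c hX, ?_⟩
    rw [sub_eq_zero] at *
    rw [smul_mul_assoc, mul_smul_comm, hX']
  lie_mem' := by
    rintro X Y ⟨hX, hX'⟩ ⟨hY, hY'⟩
    refine ⟨(so g).lie_mem hX hY, ?_⟩
    rw [sub_eq_zero] at *
    rw [LieRing.of_associative_ring_bracket, sub_mul, mul_sub, mul_assoc, hY', ← mul_assoc, hX',
      mul_assoc, mul_assoc Y, hX', ← mul_assoc Y, hY', mul_assoc]

/-- The operator `u ⊗ g(v) - v ⊗ g(u)`, i.e. `w ↦ g(v, w) u - g(u, w) v`. -/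
noncomputable def wedgeOp (g : BilinForm ℝ V) (u v : V) : Module.End ℝ V :=
  (g v).smulRight u - (g u).smulRight v

theorem wedgeOp_apply (g : BilinForm ℝ V) (u v w : V) :
    wedgeOp g u v w = g v w • u - g u w • v := rfl

theorem wedgeOp_mem_so (g : BilinForm ℝ V) (hs : g.IsSymm) (u v : V) : wedgeOp g u v ∈ so g := by
  intro x y
  simp only [wedgeOp_apply, map_sub, map_smul, LinearMap.sub_apply, LinearMap.smul_apply,
    smul_eq_mul]
  rw [hs.eq y u, hs.eq y v]
  ring

/-- The alternating map `(u, v) ↦ u ⊗ g(v) - v ⊗ g(u)` with values in `so(g)`. -/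
noncomputable def wedgeAlt (g : BilinForm ℝ V) (hs : g.IsSymm) : V [⋀^Fin 2]→ₗ[ℝ] so g where
  toFun x := ⟨wedgeOp g (x 0) (x 1), wedgeOp_mem_so g hs _ _⟩
  map_update_add' := by
    intro _ m i x y
    apply Subtype.ext
    ext w
    fin_cases i <;> simp [wedgeOp_apply, add_smul] <;> abel
  map_update_smul' := by
    intro _ m i c x
    apply Subtype.ext
    ext w
    fin_cases i <;> simp [wedgeOp_apply, mul_smul, smul_sub] <;> simp [smul_comm c]
  map_eq_zero_of_eq' := by
    intro x i j hij hne
    apply Subtype.ext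
    have : x 0 = x 1 := by
      fin_cases i <;> fin_cases j <;> simp_all
    simp [wedgeOp, this]

/-- The linear map `Λ²V → so(g)`, `u ∧ v ↦ u ⊗ g(v) - v ⊗ g(u)`. -/
noncomputable def wedgeToSo (g : BilinForm ℝ V) (hs : g.IsSymm) : ⋀[ℝ]^2 V →ₗ[ℝ] so g :=
  exteriorPower.alternatingMapLinearEquiv (wedgeAlt g hs)

theorem wedgeToSo_wedge (g : BilinForm ℝ V) (hs : g.IsSymm) (u v : V) :
    (wedgeToSo g hs (wedge u v) : Module.End ℝ V) = wedgeOp g u v := by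
  rw [wedgeToSo, wedge, exteriorPower.alternatingMapLinearEquiv_apply_ιMulti]
  rfl

theorem wedgeToSo_bijective [FiniteDimensional ℝ V] (g : BilinForm ℝ V) (hg : g.Nondegenerate)
    (hs : g.IsSymm) : Function.Bijective (wedgeToSo g hs) := by
  classical
  let b := Module.finBasis ℝ V
  let d := g.dualBasis hg b
  have hd : ∀ x : V, ∑ i, g x (b i) • d i = x := by
    intro x
    conv_rhs => rw [← d.sum_repr x]
    simp [d, BilinForm.dualBasis_repr_apply]
  have hb : ∀ x : V, ∑ i, g x (d i) • b i = x := by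
    intro x
    refine (LinearMap.ker_eq_bot.mp hg.ker_eq_bot) ?_
    apply d.ext
    intro j
    simp only [map_sum, map_smul, LinearMap.sum_apply, LinearMap.smul_apply, smul_eq_mul, d,
      BilinForm.apply_dualBasis_right hg hs]
    simp
  have h0 : ∀ x z : V, Function.update ![0, z] 0 x = ![x, z] := by
    intro x z; ext i; fin_cases i <;> simp
  have h1 : ∀ x z : V, Function.update ![z, 0] 1 x = ![z, x] := by
    intro x z; ext i; fin_cases i <;> simp
  let w2 : V →ₗ[ℝ] V →ₗ[ℝ] ⋀[ℝ]^2 V :=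
    LinearMap.mk₂ ℝ wedge
      (by
        intro x y z
        have := (exteriorPower.ιMulti ℝ 2 (M := V)).map_update_add ![0, z] 0 x y
        simpa only [h0, wedge] using this)
      (by
        intro c x z
        have := (exteriorPower.ιMulti ℝ 2 (M := V)).map_update_smul ![0, z] 0 c x
        simpa only [h0, wedge] using this)
      (by
        intro z x y
        have := (exteriorPower.ιMulti ℝ 2 (M := V)).map_update_add ![z, 0] 1 x y
        simpa only [h1, wedge] using this)
      (by
        intro c z x
        have := (exteriorPower.ιMulti ℝ 2 (M := V)).map_update_smul ![z, 0] 1 c x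
        simpa only [h1, wedge] using this)
  have hw2 : ∀ x y, w2 x y = wedge x y := fun x y => rfl
  have hswap : ∀ x y, w2 y x = - w2 x y := by
    intro x y
    have := (exteriorPower.ιMulti ℝ 2 (M := V)).map_swap ![x, y] (i := 0) (j := 1) (by decide)
    rw [hw2, hw2, wedge, wedge, ← this]
    congr 1
    ext i
    fin_cases i <;> simp
  let inv : so g →ₗ[ℝ] ⋀[ℝ]^2 V :=
    (1 / 2 : ℝ) • ∑ i, (w2.flip (d i)) ∘ₗ (LinearMap.applyₗ (b i)) ∘ₗ (so g).toSubmodule.subtype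
  have hinv : ∀ X : so g, inv X = (1 / 2 : ℝ) • ∑ i, w2 ((X : Module.End ℝ V) (b i)) (d i) := by
    intro X
    simp [inv]
    rfl
  constructor
  · have hleft : inv ∘ₗ wedgeToSo g hs = LinearMap.id := by
      apply exteriorPower.linearMap_ext
      ext x
      have hx : exteriorPower.ιMulti ℝ 2 x = w2 (x 0) (x 1) := by
        rw [hw2, wedge]
        congr 1
        ext i
        fin_cases i <;> simp
      simp only [LinearMap.compAlternatingMap_apply, LinearMap.comp_apply, LinearMap.id_apply]
      rw [hx, hinv, hw2, wedgeToSo_wedge, ← hw2]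
      simp only [wedgeOp_apply, map_sub, map_smul, LinearMap.sub_apply, LinearMap.smul_apply,
        Finset.sum_sub_distrib]
      simp only [← map_smul, ← map_sum]
      rw [hd, hd, hswap (x 0) (x 1), sub_neg_eq_add, ← two_smul ℝ, smul_smul]
      norm_num
    exact Function.LeftInverse.injective (g := inv) (fun x => LinearMap.congr_fun hleft x)
  · intro X
    refine ⟨inv X, ?_⟩
    apply Subtype.ext
    rw [hinv]
    simp only [map_smul, map_sum, hw2]
    ext v
    have hX : ∀ x y, g ((X : Module.End ℝ V) x) y = - g x ((X : Module.End ℝ V) y) :=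
      fun x y => X.2 y x
    have hXlin : ∑ i, g (d i) v • (X : Module.End ℝ V) (b i) = (X : Module.End ℝ V) v := by
      conv_rhs => rw [← hb v]
      simp only [map_sum, map_smul]
      exact Finset.sum_congr rfl fun i _ => by rw [hs.eq]
    have hXd : ∑ i, g ((X : Module.End ℝ V) (b i)) v • d i = - (X : Module.End ℝ V) v := by
      conv_rhs => rw [← hd ((X : Module.End ℝ V) v)]
      rw [← Finset.sum_neg_distrib]
      refine Finset.sum_congr rfl fun i _ => ?_
      rw [hX (b i) v, hs.eq ((X : Module.End ℝ V) v), neg_smul]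
    have hco : ((∑ i, wedgeToSo g hs (wedge ((X : Module.End ℝ V) (b i)) (d i)) : so g) :
        Module.End ℝ V) v = (2 : ℝ) • (X : Module.End ℝ V) v := by
      rw [show ((∑ i, wedgeToSo g hs (wedge ((X : Module.End ℝ V) (b i)) (d i)) : so g) :
        Module.End ℝ V) = ∑ i, wedgeOp g ((X : Module.End ℝ V) (b i)) (d i) by
          simp only [← wedgeToSo_wedge g hs]
          exact map_sum (so g).toSubmodule.subtype _ _]
      simp only [LinearMap.sum_apply, wedgeOp_apply, Finset.sum_sub_distrib]
      rw [hXlin, hXd, sub_neg_eq_add, two_smul]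
    rw [show ∀ (c : ℝ) (Y : so g), ((c • Y : so g) : Module.End ℝ V) v =
      c • (Y : Module.End ℝ V) v from fun _ _ => rfl, hco, smul_smul]
    norm_num

/-- The natural identification `Λ²V ≃ so(g)`, `u ∧ v ↦ u ⊗ g(v) - v ⊗ g(u)`. -/
noncomputable def wedgeEquivSo [FiniteDimensional ℝ V] (g : BilinForm ℝ V)
    (hg : g.Nondegenerate) (hs : g.IsSymm) : ⋀[ℝ]^2 V ≃ₗ[ℝ] so g :=
  LinearEquiv.ofBijective (wedgeToSo g hs) (wedgeToSo_bijective g hg hs)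

end So

/-! ### The derivative of a polynomial along a line of operators -/

section PolyDeriv

variable {U : Type*} [AddCommGroup U] [Module ℝ U]

/-- The curve `t ↦ p(L + tX)`, as a polynomial in `t` with coefficients in `gl(U)`. -/
noncomputable def polyCurve (p : Polynomial ℝ) (L X : Module.End ℝ U) :
    Polynomial (Module.End ℝ U) :=
  Polynomial.aeval (Polynomial.C L + Polynomial.X * Polynomial.C X) p

theorem polyCurve_coeff_zero (p : Polynomial ℝ) (L X : Module.End ℝ U) :
    (polyCurve p L X).coeff 0 = Polynomial.aeval L p := by
  unfold polyCurve
  induction p using Polynomial.induction_on' with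
  | add p q hp hq => rw [map_add, Polynomial.coeff_add, hp, hq, map_add]
  | monomial k a =>
    induction k with
    | zero => simp [Polynomial.algebraMap_apply]
    | succ k ih =>
      rw [Polynomial.aeval_monomial] at ih ⊢
      rw [pow_succ, ← mul_assoc, Polynomial.mul_coeff_zero, ih]
      simp [Polynomial.aeval_monomial, pow_succ, mul_assoc]

theorem polyCurve_coeff_one_linear (p : Polynomial ℝ) (L : Module.End ℝ U) :
    IsLinearMap ℝ (fun X : Module.End ℝ U => (polyCurve p L X).coeff 1) := by
  induction p using Polynomial.induction_on' with
  | add p q hp hq =>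
    have : (fun X : Module.End ℝ U => (polyCurve (p + q) L X).coeff 1) =
        fun X => (polyCurve p L X).coeff 1 + (polyCurve q L X).coeff 1 := by
      ext1 X
      simp [polyCurve]
    rw [this]
    exact (hp.mk' _ + hq.mk' _ : Module.End ℝ U →ₗ[ℝ] Module.End ℝ U).isLinear
  | monomial k a =>
    induction k with
    | zero =>
      have : (fun X : Module.End ℝ U => (polyCurve (Polynomial.monomial 0 a) L X).coeff 1) =
          fun X => 0 := by
        ext1 X
        simp [polyCurve, Polynomial.algebraMap_apply]
      rw [this]
      exact (0 : Module.End ℝ U →ₗ[ℝ] Module.End ℝ U).isLinear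
    | succ k ih =>
      have : (fun X : Module.End ℝ U =>
            (polyCurve (Polynomial.monomial (k + 1) a) L X).coeff 1) =
          fun X => Polynomial.aeval L (Polynomial.monomial k a) * X +
            (polyCurve (Polynomial.monomial k a) L X).coeff 1 * L := by
        ext1 X
        rw [← polyCurve_coeff_zero (Polynomial.monomial k a) L X]
        unfold polyCurve
        rw [Polynomial.aeval_monomial, Polynomial.aeval_monomial, pow_succ, ← mul_assoc,
          Polynomial.mul_coeff_one]
        simp
      rw [this]
      exact (LinearMap.mulLeft ℝ (Polynomial.aeval L (Polynomial.monomial k a)) +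
        LinearMap.mulRight ℝ L ∘ₗ ih.mk' _).isLinear

/-- The derivative `d/dt|_{t=0} p(L + tX)`. -/
noncomputable def polyDerivFun (p : Polynomial ℝ) (L X : Module.End ℝ U) : Module.End ℝ U :=
  (Polynomial.derivative (polyCurve p L X)).eval 0

theorem polyDerivFun_eq_coeff (p : Polynomial ℝ) (L X : Module.End ℝ U) :
    polyDerivFun p L X = (polyCurve p L X).coeff 1 := by
  rw [polyDerivFun, ← Polynomial.coeff_zero_eq_eval_zero, Polynomial.coeff_derivative]
  simp

/-- The linear operator `X ↦ d/dt|_{t=0} p(L + tX)` on `gl(U)`. -/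
noncomputable def polyDeriv (p : Polynomial ℝ) (L : Module.End ℝ U) :
    Module.End ℝ U →ₗ[ℝ] Module.End ℝ U where
  toFun := polyDerivFun p L
  map_add' X Y := by
    simp only [polyDerivFun_eq_coeff]
    exact (polyCurve_coeff_one_linear p L).map_add X Y
  map_smul' c X := by
    simp only [polyDerivFun_eq_coeff]
    exact (polyCurve_coeff_one_linear p L).map_smul c X

end PolyDeriv

/-! ### Jordan blocks and the block-wise operator -/

section Blocks

/-- The `n × n` Jordan block with real eigenvalue `lam`. -/
def realJordanMatrix (lam : ℝ) (n : ℕ) : Matrix (Fin n) (Fin n) ℝ :=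
  Matrix.of fun i j =>
    if i = j then lam else if (i : ℕ) + 1 = (j : ℕ) then 1 else 0

/-- The `2n × 2n` real Jordan block with complex conjugate eigenvalues `a ± ib`: the `2 × 2` blocks
on the diagonal are `!![a, b; -b, a]`, those just above it are identity matrices. -/
def complexJordanMatrix (a b : ℝ) (n : ℕ) : Matrix (Fin n × Fin 2) (Fin n × Fin 2) ℝ :=
  Matrix.of fun i j =>
    if i.1 = j.1 then (!![a, b; -b, a] : Matrix (Fin 2) (Fin 2) ℝ) i.2 j.2
    else if (i.1 : ℕ) + 1 = (j.1 : ℕ) then (1 : Matrix (Fin 2) (Fin 2) ℝ) i.2 j.2 else 0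

/-- The operator `T` consists of one real Jordan block: in some basis its matrix is a Jordan block
with a real eigenvalue, or one with a pair of non-real complex conjugate eigenvalues. -/
def IsJordanBlock {U : Type*} [AddCommGroup U] [Module ℝ U] (T : Module.End ℝ U) : Prop :=
  (∃ n : ℕ, 0 < n ∧ ∃ (lam : ℝ) (b : Module.Basis (Fin n) ℝ U),
      LinearMap.toMatrix b b T = realJordanMatrix lam n) ∨
  (∃ n : ℕ, 0 < n ∧ ∃ (x y : ℝ) (b : Module.Basis (Fin n × Fin 2) ℝ U), y ≠ 0 ∧
      LinearMap.toMatrix b b T = complexJordanMatrix x y n)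

variable {V : Type*} [AddCommGroup V] [Module ℝ V]

/-- A `g`-orthogonal decomposition of `V` into `k` subspaces on each of which `L` acts as one
Jordan block. -/
structure JordanDecomposition (g : BilinForm ℝ V) (L : Module.End ℝ V) (k : ℕ) where
  block : Fin k → Submodule ℝ V
  isInternal : DirectSum.IsInternal block
  orthogonal : ∀ i j, i ≠ j → ∀ u ∈ block i, ∀ v ∈ block j, g u v = 0
  invariant : ∀ i, ∀ v ∈ block i, L v ∈ block i
  isJordanBlock : ∀ i, IsJordanBlock (L.restrict (invariant i))

namespace JordanDecomposition

variable {g : BilinForm ℝ V} {L : Module.End ℝ V} {k : ℕ} (D : JordanDecomposition g L k)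

/-- The subspace `V_i ⊕ V_j` spanned by two blocks. -/
def pairSpace (i j : Fin k) : Submodule ℝ V := D.block i ⊔ D.block j

/-- The sum of all the blocks other than `V_i` and `V_j`. -/
def otherSpace (i j : Fin k) : Submodule ℝ V := ⨆ l ∈ ({i, j} : Set (Fin k))ᶜ, D.block l

theorem isCompl_pairSpace (i j : Fin k) : IsCompl (D.pairSpace i j) (D.otherSpace i j) := by
  have hp : D.pairSpace i j = ⨆ l ∈ ({i, j} : Set (Fin k)), D.block l := by
    rw [iSup_pair, pairSpace]
  constructor
  · rw [hp]
    exact D.isInternal.submodule_iSupIndep.disjoint_biSup_biSup disjoint_compl_right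
  · rw [codisjoint_iff, hp, otherSpace, eq_top_iff, ← D.isInternal.submodule_iSup_eq_top]
    refine iSup_le fun l => ?_
    by_cases hl : l ∈ ({i, j} : Set (Fin k))
    · exact le_sup_of_le_left (le_biSup D.block hl)
    · exact le_sup_of_le_right (le_biSup D.block (show l ∈ ({i, j} : Set (Fin k))ᶜ from hl))

/-- The projection of `V` onto `V_i ⊕ V_j` along the other blocks. -/
noncomputable def pairProj (i j : Fin k) : V →ₗ[ℝ] D.pairSpace i j :=
  (D.pairSpace i j).projectionOnto (D.otherSpace i j) (D.isCompl_pairSpace i j)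

theorem pairSpace_invariant (i j : Fin k) : ∀ v ∈ D.pairSpace i j, L v ∈ D.pairSpace i j := by
  intro v hv
  obtain ⟨x, hx, y, hy, rfl⟩ := Submodule.mem_sup.mp hv
  rw [map_add]
  exact Submodule.add_mem_sup (D.invariant i x hx) (D.invariant j y hy)

/-- The restriction of `L` to `V_i ⊕ V_j`. -/
def pairOp (i j : Fin k) : Module.End ℝ (D.pairSpace i j) :=
  L.restrict (D.pairSpace_invariant i j)

/-- The part of an operator `X` on `V` that is carried by the four blocks with indices in
`{i, j}`, as an operator on `V_i ⊕ V_j`. -/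
noncomputable def compress (i j : Fin k) :
    Module.End ℝ V →ₗ[ℝ] Module.End ℝ (D.pairSpace i j) where
  toFun X := D.pairProj i j ∘ₗ X ∘ₗ (D.pairSpace i j).subtype
  map_add' X Y := by ext; simp
  map_smul' c X := by ext; simp

/-- The extension by zero of an operator on `V_i ⊕ V_j` to the other blocks. -/
noncomputable def extend (i j : Fin k) :
    Module.End ℝ (D.pairSpace i j) →ₗ[ℝ] Module.End ℝ V where
  toFun Y := (D.pairSpace i j).subtype ∘ₗ Y ∘ₗ D.pairProj i j
  map_add' X Y := by ext; simp
  map_smul' c X := by ext; simp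

/-- The operator `R̂_ij` on `so(g)`: apply `X ↦ d/dt|_{t=0} p(L_ij + tX)` on `V_i ⊕ V_j`, where `p`
is the minimal polynomial of the restriction `L_ij` of `L`, and extend the result by zero. -/
noncomputable def rHat (i j : Fin k) : so g →ₗ[ℝ] Module.End ℝ V :=
  D.extend i j ∘ₗ polyDeriv (minpoly ℝ (D.pairOp i j)) (D.pairOp i j) ∘ₗ D.compress i j ∘ₗ
    (so g).toSubmodule.subtype

/-- The block-wise operator `R_formal = ∑_{i < j} R̂_ij` on `so(g)`. -/
noncomputable def rFormal : so g →ₗ[ℝ] Module.End ℝ V :=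
  ∑ i, ∑ j ∈ Finset.Ioi i, D.rHat i j

end JordanDecomposition

end Blocks

end JordanCurvature

/-!
Write `D_p(X)` for the derivative of `p(L + tX)` at `t = 0`. It obeys the Leibniz rule, so
statements about it are proved by induction on `p`, and `R̂_ij(X) = D_p(QXQ)`, where `Q` is the
projection on `V_i ⊕ V_j` and `p` the minimal polynomial of `L_ij`.

*Values and Bianchi identity.* Differentiating `[p(L + tX), L + tX] = 0` gives
`[D_p(X), L] = [X, p(L)]`, and `p(L)` vanishes on `V_i ⊕ V_j`, so the values of `R̂_ij` commute with
`L`; they are skew because `D_p` respects adjoints (`rHat_mem`). For the operator `u ⊗ g(v)` the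
vector `D_p(u ⊗ g(v)) w` is symmetric in `v` and `w` (`polyDeriv_smulRight_symm`), and in the cyclic
sum everything cancels (`rHat_bianchi`).

*Image.* Only the cyclicity of the blocks matters. A skew operator commuting with `L` has no
diagonal blocks, since on a cyclic space a commuting operator is a polynomial in `L`, hence
symmetric (`blockEnd_mul_mul_self`). For the other blocks, let `e₁`, `e₂` generate `V_i`, `V_j`, let
`p₂` be the annihilator of `e₂`, of degree `d`, and `p = p₂ r`. If `Z : V_j → V_i` kills `Lᵇ e₂` for
`b < d - 1` and maps `L^(d-1) e₂` to `f`, then `D_p(Z) e₂ = r(L) f`. An intertwiner `W` satisfies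
`p₂(L) W e₂ = 0`, which forces `W e₂` to be of the form `r(L) f`, so `W = D_p(Z)`
(`exists_polyDeriv_eq`). Skew-symmetrising `Z` shows that `R_formal` is onto (`range_rFormal`).

*Existence of decompositions.* Let `q ^ (m + 1)` be the exact power of an irreducible `q` in the
minimal polynomial `q ^ (m + 1) r` of `L`. The symmetric form `g(q(L)ᵐ r(L) x, y)` is not zero, so
it is not zero on the diagonal, at `v₀` say. Then `v = r(L) v₀` generates a non-degenerate cyclic
subspace with annihilator `q ^ (m + 1)` (`exists_jordan_subspace`), which splits off together with
its orthogonal complement.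

*Cyclic spaces and Jordan blocks.* On `ℝ[X]/(qⁿ)` with `q = (X - a)² + b²`, Newton approximation
writes `X = a + bJ + N` with `J² = -1` and `Nⁿ = 0`, and in the basis `Nᵐ`, `-J Nᵐ` multiplication
by `X` is a real Jordan block (`exists_basis_complexJordan`). Hence Jordan blocks are the same as
cyclic operators whose annihilator is a power of an irreducible polynomial
(`isJordanBlock_of_cyclic`, `IsJordanBlock.exists_cyclic`).
-/

namespace JordanCurvature

open Polynomial

/-! ### Calculus of the derivative of a polynomial along a line of operators -/

section PolyDeriv

variable {U : Type*} [AddCommGroup U] [Module ℝ U]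

theorem polyDeriv_apply (p : ℝ[X]) (L X : Module.End ℝ U) :
    polyDeriv p L X = (polyCurve p L X).coeff 1 :=
  polyDerivFun_eq_coeff p L X

theorem polyDeriv_add (p q : ℝ[X]) (L X : Module.End ℝ U) :
    polyDeriv (p + q) L X = polyDeriv p L X + polyDeriv q L X := by
  simp [polyDeriv_apply, polyCurve]

theorem polyDeriv_C (a : ℝ) (L X : Module.End ℝ U) : polyDeriv (C a) L X = 0 := by
  simp [polyDeriv_apply, polyCurve, Polynomial.algebraMap_apply]

theorem polyDeriv_X (L X : Module.End ℝ U) : polyDeriv Polynomial.X L X = X := by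
  simp [polyDeriv_apply, polyCurve]

/-- The Leibniz rule; the factors are kept in order because operators do not commute. -/
theorem polyDeriv_mul (p q : ℝ[X]) (L X : Module.End ℝ U) :
    polyDeriv (p * q) L X = aeval L p * polyDeriv q L X + polyDeriv p L X * aeval L q := by
  simp only [polyDeriv_apply, ← polyCurve_coeff_zero _ L X]
  rw [← Polynomial.mul_coeff_one]
  simp [polyCurve]

theorem polyDeriv_mul_X (p : ℝ[X]) (L X : Module.End ℝ U) :
    polyDeriv (p * Polynomial.X) L X = aeval L p * X + polyDeriv p L X * L := by
  rw [polyDeriv_mul, polyDeriv_X, aeval_X]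

theorem polyDeriv_mul_X' (p : ℝ[X]) (L X : Module.End ℝ U) :
    polyDeriv (p * Polynomial.X) L X = L * polyDeriv p L X + X * aeval L p := by
  rw [mul_comm, polyDeriv_mul, polyDeriv_X, aeval_X]

/-- A property of polynomials that holds for constants and is stable under addition and under
multiplication by the variable holds for all polynomials. -/
theorem polynomial_induction {M : ℝ[X] → Prop} (p : ℝ[X]) (hC : ∀ a, M (C a))
    (hadd : ∀ p q, M p → M q → M (p + q)) (hX : ∀ p, M p → M (p * Polynomial.X)) : M p := by
  induction p using Polynomial.induction_on with
  | C a => exact hC a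
  | add p q hp hq => exact hadd p q hp hq
  | monomial n a h => rw [pow_succ, ← mul_assoc]; exact hX _ h

/-- Differentiating `[p(L + tX), L + tX] = 0` at `t = 0`. -/
theorem polyDeriv_commutator (p : ℝ[X]) (L X : Module.End ℝ U) :
    polyDeriv p L X * L - L * polyDeriv p L X = X * aeval L p - aeval L p * X := by
  have h₁ := polyDeriv_mul_X p L X
  rw [polyDeriv_mul_X'] at h₁
  rw [sub_eq_sub_iff_add_eq_add, add_comm _ (aeval L p * X), ← h₁, add_comm]

theorem polyDeriv_mul_right (p : ℝ[X]) {L Q : Module.End ℝ U} (hQ : Commute L Q)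
    (X : Module.End ℝ U) : polyDeriv p L (X * Q) = polyDeriv p L X * Q := by
  induction p using polynomial_induction with
  | hC a => simp [polyDeriv_C]
  | hadd p q hp hq => simp only [polyDeriv_add, hp, hq, add_mul]
  | hX p hp => simp only [polyDeriv_mul_X, hp, add_mul, mul_assoc, hQ.eq]

end PolyDeriv

/-! ### Adjoints and the Bianchi symmetry of the derivative -/

theorem aeval_mul_comm {U : Type*} [AddCommGroup U] [Module ℝ U] (p : ℝ[X])
    (L : Module.End ℝ U) : aeval L p * L = L * aeval L p := by
  have := congrArg (aeval L) (mul_comm p Polynomial.X)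
  simpa using this

section Adjoint

variable {V : Type*} [AddCommGroup V] [Module ℝ V] {g : LinearMap.BilinForm ℝ V}
  {L : Module.End ℝ V}

theorem aeval_symm (hL : ∀ u v : V, g (L v) u = g v (L u)) (p : ℝ[X]) (u v : V) :
    g (aeval L p v) u = g v (aeval L p u) := by
  induction p using polynomial_induction generalizing u v with
  | hC a => simp
  | hadd p q hp hq => simp [hp, hq]
  | hX p hp =>
    rw [map_mul, aeval_X, Module.End.mul_apply, hp, hL, ← Module.End.mul_apply L,
      aeval_mul_comm]

/-- If `B` is adjoint to `A`, then the derivatives of `p(L + tA)` and `p(L + tB)` are adjoint. -/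
theorem polyDeriv_adjoint (hL : ∀ u v : V, g (L v) u = g v (L u)) (p : ℝ[X])
    {A B : Module.End ℝ V} (h : ∀ u v : V, g (A u) v = g u (B v)) (u v : V) :
    g (polyDeriv p L A u) v = g u (polyDeriv p L B v) := by
  induction p using polynomial_induction generalizing u v with
  | hC a => simp [polyDeriv_C]
  | hadd p q hp hq => simp [polyDeriv_add, hp, hq]
  | hX p hp =>
    rw [polyDeriv_mul_X, polyDeriv_mul_X']
    simp only [LinearMap.add_apply, Module.End.mul_apply, map_add, hp, hL, aeval_symm hL, h]
    ring

/-- Both sides are `∑ cₘ ∑ g(Lᵇ v, w) Lᵃ u` over `a + b = m - 1`, which is symmetric in `v`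
and `w`. -/
theorem polyDeriv_smulRight_symm (hs : g.IsSymm) (hL : ∀ u v : V, g (L v) u = g v (L u))
    (p : ℝ[X]) (u v w : V) :
    polyDeriv p L ((g v).smulRight u) w = polyDeriv p L ((g w).smulRight u) v := by
  induction p using polynomial_induction with
  | hC a => simp [polyDeriv_C]
  | hadd p q hp hq => simp [polyDeriv_add, hp, hq]
  | hX p hp =>
    rw [polyDeriv_mul_X', polyDeriv_mul_X']
    simp only [LinearMap.add_apply, Module.End.mul_apply, hp, LinearMap.smulRight_apply]
    rw [← aeval_symm hL, hs.eq]

end Adjoint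

/-! ### Cyclic vectors and surjectivity of the derivative onto intertwiners -/

section Cyclic

variable {V : Type*} [AddCommGroup V] [Module ℝ V] {L : Module.End ℝ V}

theorem aeval_mem (W : Submodule ℝ V) (hW : ∀ v ∈ W, L v ∈ W) (p : ℝ[X]) {v : V} (hv : v ∈ W) :
    aeval L p v ∈ W := by
  induction p using polynomial_induction generalizing v with
  | hC a => simpa using W.smul_mem a hv
  | hadd p q hp hq => simpa using W.add_mem (hp hv) (hq hv)
  | hX p hp => simpa using hp (hW v hv)

/-- The annihilator of a vector in `ℝ[X]` is generated by a monic polynomial. -/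
theorem exists_monic_annihilator [FiniteDimensional ℝ V] (L : Module.End ℝ V) (v : V) :
    ∃ p : ℝ[X], p.Monic ∧ ∀ f : ℝ[X], aeval L f v = 0 ↔ p ∣ f := by
  let I : Ideal ℝ[X] :=
    { carrier := {f | aeval L f v = 0}
      zero_mem' := by simp
      add_mem' := by
        intro a b (ha : aeval L a v = 0) (hb : aeval L b v = 0)
        simp [ha, hb]
      smul_mem' := by
        intro c x (hx : aeval L x v = 0)
        simp [hx] }
  have hI : ∀ f : ℝ[X], aeval L f v = 0 ↔ Submodule.IsPrincipal.generator I ∣ f := fun f =>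
    (Submodule.IsPrincipal.mem_iff_generator_dvd I (x := f))
  have hne : Submodule.IsPrincipal.generator I ≠ 0 := by
    intro h0
    have h1 := (hI (minpoly ℝ L)).mp (by simp)
    rw [h0, zero_dvd_iff] at h1
    exact minpoly.ne_zero (Algebra.IsIntegral.isIntegral L) h1
  exact ⟨normalize (Submodule.IsPrincipal.generator I), Polynomial.monic_normalize hne,
    fun f => by rw [hI, normalize_dvd_iff]⟩

/-- Divided differences: let `p` be monic of degree `d + 1`. If `Z` kills `Lᵇ v` for `b < d` and
sends `L^d v` to `f`, then in `∑ cₘ ∑ Lᵃ Z Lᵇ v`, where `a + b = m - 1`, only the term with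
`m = d + 1` and `a = 0` survives. -/
theorem polyDeriv_apply_of_top (Z : Module.End ℝ V) (v f : V) (d : ℕ)
    (hZ : ∀ b < d, Z ((L ^ b) v) = 0) (hZd : Z ((L ^ d) v) = f) (p : ℝ[X]) (hp : p.Monic)
    (hd : p.natDegree = d + 1) : polyDeriv p L Z v = f := by
  -- powers of `X` up to `d` contribute nothing
  have hpow : ∀ m ≤ d, polyDeriv (Polynomial.X ^ m) L Z v = 0 := by
    intro m
    induction m with
    | zero => intro _; simpa using DFunLike.congr_fun (polyDeriv_C 1 L Z) v
    | succ m ih =>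
      intro hm
      rw [pow_succ, polyDeriv_mul_X']
      simp [ih (by omega), hZ m (by omega)]
  have hlin : ∀ q : ℝ[X], polyDeriv q L Z v =
      ∑ i ∈ Finset.range (q.natDegree + 1), q.coeff i • polyDeriv (Polynomial.X ^ i) L Z v := by
    intro q
    let T : ℝ[X] →+ V :=
      { toFun := fun q => polyDeriv q L Z v
        map_zero' := by simpa using DFunLike.congr_fun (polyDeriv_C 0 L Z) v
        map_add' := fun a b => by simp [polyDeriv_add] }
    change T q = _
    conv_lhs => rw [q.as_sum_range_C_mul_X_pow]
    rw [map_sum]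
    refine Finset.sum_congr rfl fun i _ => ?_
    change polyDeriv _ L Z v = _
    rw [polyDeriv_mul, polyDeriv_C]
    simp
  rw [hlin, hd, Finset.sum_range_succ, Finset.sum_eq_zero, zero_add]
  · rw [show p.coeff (d + 1) = 1 by rw [← hd]; exact hp, one_smul, pow_succ, polyDeriv_mul_X']
    simp [hpow d le_rfl, hZd]
  · intro i hi
    rw [hpow i (by simpa [Nat.lt_succ_iff] using hi), smul_zero]

/-- There is a functional that singles out the top power of `L` on a cyclic vector. -/
theorem exists_functional [FiniteDimensional ℝ V] (v : V) (d : ℕ) (p : ℝ[X])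
    (hd : p.natDegree = d + 1) (hann : ∀ f : ℝ[X], aeval L f v = 0 ↔ p ∣ f) :
    ∃ φ : V →ₗ[ℝ] ℝ, (∀ b < d, φ ((L ^ b) v) = 0) ∧ φ ((L ^ d) v) = 1 := by
  let S : Submodule ℝ V := (Polynomial.degreeLT ℝ d).map
    ((LinearMap.applyₗ v) ∘ₗ (aeval L : ℝ[X] →ₐ[ℝ] Module.End ℝ V).toLinearMap)
  have hnot : (L ^ d) v ∉ S := by
    rintro ⟨f, hf, hfv⟩
    have h0 : aeval L (Polynomial.X ^ d - f) v = 0 := by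
      have : aeval L f v = (L ^ d) v := hfv
      simp [this]
    have hdeg : f.degree < d := Polynomial.mem_degreeLT.mp hf
    have hmon : (Polynomial.X ^ d - f).Monic := Polynomial.monic_X_pow_sub hdeg
    have hle := Polynomial.natDegree_le_of_dvd ((hann _).mp h0) hmon.ne_zero
    have : (Polynomial.X ^ d - f).natDegree = d := by
      refine Polynomial.natDegree_eq_of_degree_eq_some ?_
      rw [Polynomial.degree_sub_eq_left_of_degree_lt (by simpa using hdeg),
        Polynomial.degree_X_pow]
    omega
  obtain ⟨φ, hφ, hφS⟩ := Submodule.exists_le_ker_of_notMem hnot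
  refine ⟨(φ ((L ^ d) v))⁻¹ • φ, fun b hb => ?_, by simp [hφ]⟩
  have : (L ^ b) v ∈ S :=
    ⟨Polynomial.X ^ b, Polynomial.mem_degreeLT.mpr (by
      rw [Polynomial.degree_X_pow]; exact_mod_cast hb), by simp⟩
  have h0 : φ ((L ^ b) v) = 0 := hφS this
  simp [h0]

theorem aeval_comm_of_comm {A : Module.End ℝ V} (hA : A * L = L * A) (q : ℝ[X]) :
    A * aeval L q = aeval L q * A := by
  induction q using polynomial_induction with
  | hC a => simp [Algebra.algebraMap_eq_smul_one]
  | hadd p q hp hq => simp only [map_add, mul_add, add_mul, hp, hq]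
  | hX p hp => rw [map_mul, aeval_X, ← mul_assoc, hp, mul_assoc, hA, mul_assoc]

/-- Any operator `W` that intertwines the cyclic modules of `e₂` and `e₁` is a derivative
`d/dt p(L + tZ)`, where `p` is the lowest common multiple of the two annihilators. Writing
`p = p₂ r` with `p₂` the annihilator of `e₂`, the derivative equals `r(L) (d/dt p₂(L + tZ))` on
`e₂`, and `W e₂` is divisible by `r(L)`. -/
theorem exists_polyDeriv_eq [FiniteDimensional ℝ V] {W Q : Module.End ℝ V} {e₁ e₂ : V}
    {p h : ℝ[X]} (hWL : W * L = L * W) (hQL : Commute L Q) (hWQ : W * Q = W)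
    (hQ : ∀ u, ∃ f : ℝ[X], Q u = aeval L f e₂) (hQe : Q e₂ = e₂)
    (hp₁ : aeval L p e₁ = 0) (hp₂ : aeval L p e₂ = 0)
    (hp : ∀ f : ℝ[X], aeval L f e₁ = 0 → aeval L f e₂ = 0 → p ∣ f)
    (hWe : W e₂ = aeval L h e₁) :
    ∃ (f : ℝ[X]) (φ : V →ₗ[ℝ] ℝ),
      polyDeriv p L ((φ ∘ₗ Q).smulRight (aeval L f e₁)) = W := by
  have hcomm : ∀ (A : Module.End ℝ V), A * L = L * A → ∀ q : ℝ[X], A * aeval L q = aeval L q * A :=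
    fun A hA q => aeval_comm_of_comm hA q
  obtain ⟨p₂, hmon, hann⟩ := exists_monic_annihilator L e₂
  obtain ⟨r, hr⟩ := (hann p).mp hp₂
  -- `W e₂ = r(L) f(L) e₁` for some `f`
  have hdvd : p ∣ p₂ * h := by
    refine hp _ ?_ ?_
    · rw [map_mul, Module.End.mul_apply, ← hWe, ← Module.End.mul_apply, ← hcomm W hWL,
        Module.End.mul_apply, (hann p₂).mpr dvd_rfl, map_zero]
    · rw [(hann _)]; exact dvd_mul_right _ _
  rw [hr, mul_dvd_mul_iff_left hmon.ne_zero] at hdvd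
  obtain ⟨f, hf⟩ := hdvd
  rcases Nat.eq_zero_or_pos p₂.natDegree with h0 | hpos
  · have h1 : p₂ = 1 := Polynomial.eq_one_of_monic_natDegree_zero hmon h0
    have he : e₂ = 0 := by simpa [h1] using (hann 1)
    refine ⟨0, 0, ?_⟩
    have hW : W = 0 := by
      rw [← hWQ]
      ext u
      obtain ⟨f, hf⟩ := hQ u
      simp [hf, he]
    rw [hW, map_zero, LinearMap.zero_apply, LinearMap.smulRight_zero, map_zero]
  · obtain ⟨d, hd⟩ := Nat.exists_eq_succ_of_ne_zero hpos.ne'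
    obtain ⟨φ, hφ, hφd⟩ := exists_functional e₂ d p₂ hd hann
    refine ⟨f, φ, ?_⟩
    set Z : Module.End ℝ V := (φ ∘ₗ Q).smulRight (aeval L f e₁) with hZ
    have hQpow : ∀ b, Q ((L ^ b) e₂) = (L ^ b) e₂ := fun b => by
      rw [← Module.End.mul_apply, ← (hQL.pow_left b).eq, Module.End.mul_apply, hQe]
    have htop : polyDeriv p₂ L Z e₂ = aeval L f e₁ := by
      refine polyDeriv_apply_of_top Z e₂ _ d (fun b hb => ?_) ?_ p₂ hmon hd
      · simp [hZ, hQpow, hφ b hb]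
      · simp [hZ, hQpow, hφd]
    have he : polyDeriv p L Z e₂ = W e₂ := by
      rw [hr, mul_comm, polyDeriv_mul, LinearMap.add_apply, Module.End.mul_apply,
        Module.End.mul_apply, htop, (hann p₂).mpr dvd_rfl, map_zero, add_zero, hWe, hf, map_mul,
        Module.End.mul_apply]
    have hZQ : Z * Q = Z := by
      ext u
      obtain ⟨f, hf⟩ := hQ u
      have : Q (Q u) = Q u := by
        rw [hf, ← Module.End.mul_apply, hcomm Q hQL.symm f, Module.End.mul_apply, hQe]
      simp [hZ, this]
    -- since `p(L)` annihilates both cyclic modules, the derivative commutes with `L`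
    have hDL : polyDeriv p L Z * L = L * polyDeriv p L Z := by
      rw [← sub_eq_zero, polyDeriv_commutator]
      have h1 : Z * aeval L p = 0 := by
        rw [← hZQ, mul_assoc, hcomm Q hQL.symm p]
        ext u
        obtain ⟨q, hq⟩ := hQ u
        simp only [Module.End.mul_apply, hq, LinearMap.zero_apply]
        rw [← Module.End.mul_apply (aeval L p), ← map_mul, mul_comm, map_mul,
          Module.End.mul_apply, hp₂, map_zero, map_zero]
      have h2 : aeval L p * Z = 0 := by
        ext u
        simp only [Module.End.mul_apply, hZ, LinearMap.smulRight_apply, map_smul,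
          LinearMap.zero_apply]
        rw [← Module.End.mul_apply (aeval L p), ← map_mul, mul_comm p, map_mul,
          Module.End.mul_apply, hp₁, map_zero, smul_zero]
      rw [h1, h2, sub_zero]
    rw [← hWQ, ← hZQ, polyDeriv_mul_right p hQL]
    ext u
    obtain ⟨q, hq⟩ := hQ u
    simp only [Module.End.mul_apply, hq]
    rw [← Module.End.mul_apply, ← Module.End.mul_apply, hcomm _ hDL, hcomm _ hWL,
      Module.End.mul_apply, Module.End.mul_apply, he]

end Cyclic

/-! ### Block projections and the operators `R̂_ij` -/

namespace JordanDecomposition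

variable {V : Type*} [AddCommGroup V] [Module ℝ V] {g : LinearMap.BilinForm ℝ V}
  {L : Module.End ℝ V} {k : ℕ} (D : JordanDecomposition g L k)

/-- The projection onto `V_i ⊕ V_j` along the other blocks, as an operator on `V`. -/
noncomputable def pairEnd (i j : Fin k) : Module.End ℝ V := D.extend i j 1

/-- The projection onto `V_i` along the other blocks, as an operator on `V`. -/
noncomputable def blockEnd (i : Fin k) : Module.End ℝ V := D.pairEnd i i

theorem block_induction {M : V → Prop} (v : V) (hb : ∀ i, ∀ x ∈ D.block i, M x) (h0 : M 0)
    (hadd : ∀ x y, M x → M y → M (x + y)) : M v := by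
  have hv : v ∈ ⨆ i, D.block i := by
    rw [D.isInternal.submodule_iSup_eq_top]; trivial
  exact Submodule.iSup_induction D.block (motive := M) hv hb h0 hadd

theorem ext_block {A B : Module.End ℝ V} (h : ∀ i, ∀ x ∈ D.block i, A x = B x) : A = B := by
  ext v
  refine D.block_induction (M := fun v => A v = B v) v h (by simp) fun x y hx hy => ?_
  rw [map_add, map_add, hx, hy]

theorem pairEnd_apply (i j : Fin k) (v : V) : D.pairEnd i j v = D.pairProj i j v := rfl

theorem pairEnd_mem (i j : Fin k) (v : V) : D.pairEnd i j v ∈ D.pairSpace i j :=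
  (D.pairProj i j v).2

theorem blockEnd_mem (i : Fin k) (v : V) : D.blockEnd i v ∈ D.block i := by
  have := D.pairEnd_mem i i v
  rwa [pairSpace, sup_idem] at this

theorem pairEnd_apply_pairSpace {i j : Fin k} {v : V} (hv : v ∈ D.pairSpace i j) :
    D.pairEnd i j v = v := by
  rw [pairEnd_apply, pairProj, Submodule.projectionOnto_apply_of_mem_left _ hv]

theorem pairEnd_apply_block {i j l : Fin k} {v : V} (hv : v ∈ D.block l) :
    D.pairEnd i j v = if l = i ∨ l = j then v else 0 := by
  split_ifs with h
  · refine D.pairEnd_apply_pairSpace ?_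
    rcases h with rfl | rfl
    · exact Submodule.mem_sup_left hv
    · exact Submodule.mem_sup_right hv
  · have hv' : v ∈ D.otherSpace i j :=
      (le_biSup D.block (show l ∈ ({i, j} : Set (Fin k))ᶜ by simpa using h)) hv
    rw [pairEnd_apply, pairProj, Submodule.projectionOnto_apply_of_mem_right _ hv']
    rfl

theorem blockEnd_apply_block {i l : Fin k} {v : V} (hv : v ∈ D.block l) :
    D.blockEnd i v = if l = i then v else 0 := by
  simp only [blockEnd, D.pairEnd_apply_block hv, or_self]

theorem pairEnd_mul_blockEnd (i j l : Fin k) :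
    D.pairEnd i j * D.blockEnd l = if l = i ∨ l = j then D.blockEnd l else 0 := by
  ext v
  rw [Module.End.mul_apply, D.pairEnd_apply_block (D.blockEnd_mem l v)]
  split_ifs <;> rfl

theorem blockEnd_mul_pairEnd (i j l : Fin k) :
    D.blockEnd l * D.pairEnd i j = if l = i ∨ l = j then D.blockEnd l else 0 := by
  refine D.ext_block fun m x hx => ?_
  rw [Module.End.mul_apply, D.pairEnd_apply_block hx]
  by_cases h1 : l = i ∨ l = j <;> by_cases h2 : m = i ∨ m = j <;>
    simp only [h1, h2, if_true, if_false, D.blockEnd_apply_block hx, map_zero,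
      LinearMap.zero_apply] <;> split_ifs with h3 <;> simp_all

theorem sum_blockEnd : ∑ i, D.blockEnd i = 1 := by
  refine D.ext_block fun l x hx => ?_
  simp [LinearMap.sum_apply, D.blockEnd_apply_block hx]

theorem commute_pairEnd (i j : Fin k) : Commute L (D.pairEnd i j) := by
  refine D.ext_block fun l x hx => ?_
  rw [Module.End.mul_apply, Module.End.mul_apply, D.pairEnd_apply_block hx,
    D.pairEnd_apply_block (D.invariant l x hx)]
  split_ifs <;> simp

theorem commute_blockEnd (i : Fin k) : Commute L (D.blockEnd i) := D.commute_pairEnd i i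

theorem pairEnd_symm (i j : Fin k) (u v : V) :
    g (D.pairEnd i j u) v = g u (D.pairEnd i j v) := by
  refine D.block_induction (M := fun u => g (D.pairEnd i j u) v = g u (D.pairEnd i j v)) u ?_
    (by simp) fun x y hx hy => by simp [hx, hy]
  intro a x hx
  refine D.block_induction (M := fun v => g (D.pairEnd i j x) v = g x (D.pairEnd i j v)) v ?_
    (by simp) fun x y hx hy => by simp [hx, hy]
  intro b y hy
  rw [D.pairEnd_apply_block hx, D.pairEnd_apply_block hy]
  by_cases hab : a = b
  · subst hab; split_ifs <;> simp
  · have := D.orthogonal a b hab x hx y hy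
    split_ifs <;> simp [this]

theorem blockEnd_symm (i : Fin k) (u v : V) : g (D.blockEnd i u) v = g u (D.blockEnd i v) :=
  D.pairEnd_symm i i u v

theorem coe_aeval_pairOp (i j : Fin k) (p : ℝ[X]) (y : D.pairSpace i j) :
    ((aeval (D.pairOp i j) p y : D.pairSpace i j) : V) = aeval L p (y : V) := by
  induction p using polynomial_induction generalizing y with
  | hC a => simp
  | hadd p q hp hq => simp [hp, hq]
  | hX p hp => simp [hp]; rfl

theorem extend_polyDeriv (i j : Fin k) (p : ℝ[X]) (Y : Module.End ℝ (D.pairSpace i j)) :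
    D.extend i j (polyDeriv p (D.pairOp i j) Y) = polyDeriv p L (D.extend i j Y) := by
  induction p using polynomial_induction with
  | hC a => simp [polyDeriv_C]
  | hadd p q hp hq => simp [polyDeriv_add, hp, hq]
  | hX p hp =>
    rw [polyDeriv_mul_X, polyDeriv_mul_X, ← hp, map_add]
    congr 1
    · ext v
      exact D.coe_aeval_pairOp i j p _
    · ext v
      have : D.pairProj i j (L v) = D.pairOp i j (D.pairProj i j v) :=
        Subtype.ext (DFunLike.congr_fun (D.commute_pairEnd i j).eq v).symm
      change ((polyDeriv p (D.pairOp i j) Y (D.pairOp i j (D.pairProj i j v)) :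
        D.pairSpace i j) : V) = (polyDeriv p (D.pairOp i j) Y (D.pairProj i j (L v)) :
        D.pairSpace i j)
      rw [this]

theorem rHat_apply (i j : Fin k) (X : so g) :
    D.rHat i j X = polyDeriv (minpoly ℝ (D.pairOp i j)) L
      (D.pairEnd i j * (X : Module.End ℝ V) * D.pairEnd i j) :=
  D.extend_polyDeriv i j _ _

theorem aeval_minpoly_pairOp {i j : Fin k} {v : V} (hv : v ∈ D.pairSpace i j) :
    aeval L (minpoly ℝ (D.pairOp i j)) v = 0 := by
  have := D.coe_aeval_pairOp i j (minpoly ℝ (D.pairOp i j)) ⟨v, hv⟩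
  simpa using this.symm

theorem aeval_minpoly_mul_pairEnd (i j : Fin k) :
    aeval L (minpoly ℝ (D.pairOp i j)) * D.pairEnd i j = 0 := by
  ext v
  exact D.aeval_minpoly_pairOp (D.pairEnd_mem i j v)

theorem pairEnd_mul_aeval_minpoly (i j : Fin k) :
    D.pairEnd i j * aeval L (minpoly ℝ (D.pairOp i j)) = 0 := by
  rw [aeval_comm_of_comm (D.commute_pairEnd i j).symm.eq, aeval_minpoly_mul_pairEnd]

theorem minpoly_pairOp_dvd {i j : Fin k} {f : ℝ[X]} (hi : ∀ v ∈ D.block i, aeval L f v = 0)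
    (hj : ∀ v ∈ D.block j, aeval L f v = 0) : minpoly ℝ (D.pairOp i j) ∣ f := by
  refine minpoly.dvd _ _ ?_
  ext y
  rw [D.coe_aeval_pairOp i j f y]
  obtain ⟨a, ha, b, hb, hab⟩ := Submodule.mem_sup.mp y.2
  rw [← hab, map_add, hi a ha, hj b hb]
  simp

/-- The values of `R̂_ij` are skew and commute with `L`. -/
theorem rHat_mem (hL : ∀ u v : V, g (L v) u = g v (L u)) (i j : Fin k) (X : so g) :
    D.rHat i j X ∈ centraliserSo g L := by
  rw [rHat_apply]
  constructor
  -- the compression of `X` is adjoint to its negative, hence so is the derivative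
  · intro u v
    rw [polyDeriv_adjoint hL _ (B := -(D.pairEnd i j * (X : Module.End ℝ V) * D.pairEnd i j)),
      map_neg]
    · simp
    · intro a b
      have hX : ∀ a b : V, g ((X : Module.End ℝ V) a) b = - g a ((X : Module.End ℝ V) b) :=
        fun a b => X.2 b a
      simp [D.pairEnd_symm, hX]
  · rw [polyDeriv_commutator, mul_assoc, D.pairEnd_mul_aeval_minpoly, mul_zero, ← mul_assoc,
      ← mul_assoc, D.aeval_minpoly_mul_pairEnd, zero_mul, zero_mul, sub_zero]

theorem rFormal_apply (X : so g) : D.rFormal X = ∑ i, ∑ j ∈ Finset.Ioi i, D.rHat i j X := by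
  simp [rFormal, LinearMap.sum_apply]

theorem rFormal_mem (hL : ∀ u v : V, g (L v) u = g v (L u)) (X : so g) :
    D.rFormal X ∈ centraliserSo g L := by
  rw [rFormal_apply]
  exact sum_mem fun i _ => sum_mem fun j _ => D.rHat_mem hL i j X

/-- The Bianchi identity for `R̂_ij`. -/
theorem rHat_bianchi (hs : g.IsSymm) (hL : ∀ u v : V, g (L v) u = g v (L u)) (i j : Fin k)
    (u v w : V) :
    D.rHat i j (wedgeToSo g hs (wedge u v)) w + D.rHat i j (wedgeToSo g hs (wedge v w)) u +
      D.rHat i j (wedgeToSo g hs (wedge w u)) v = 0 := by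
  set Q := D.pairEnd i j with hQ
  have hQQ : ∀ x, Q (Q x) = Q x := fun x => D.pairEnd_apply_pairSpace (D.pairEnd_mem i j x)
  have key : ∀ x y z : V, D.rHat i j (wedgeToSo g hs (wedge x y)) z =
      polyDeriv (minpoly ℝ (D.pairOp i j)) L ((g (Q y)).smulRight (Q x)) (Q z) -
      polyDeriv (minpoly ℝ (D.pairOp i j)) L ((g (Q x)).smulRight (Q y)) (Q z) := by
    intro x y z
    have h1 : Q * wedgeOp g x y * Q =
        ((g (Q y)).smulRight (Q x) - (g (Q x)).smulRight (Q y)) * Q := by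
      ext a
      simp only [Module.End.mul_apply, wedgeOp_apply, map_sub, map_smul, LinearMap.sub_apply,
        LinearMap.smulRight_apply]
      rw [hQ, D.pairEnd_symm, D.pairEnd_symm, ← hQ, hQQ]
    rw [rHat_apply, wedgeToSo_wedge, h1, polyDeriv_mul_right _ (D.commute_pairEnd i j), map_sub]
    rfl
  rw [key, key, key, polyDeriv_smulRight_symm hs hL _ (Q u) (Q v) (Q w),
    polyDeriv_smulRight_symm hs hL _ (Q v) (Q u) (Q w),
    polyDeriv_smulRight_symm hs hL _ (Q w) (Q v) (Q u)]
  abel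

/-! ### The image of `R_formal` -/

/-- A skew operator that commutes with `L` has no diagonal blocks: such a block commutes with the
cyclic operator `L|_{V_i}`, so it is a polynomial in it and thus symmetric as well as skew. -/
theorem blockEnd_mul_mul_self (hg : g.Nondegenerate) (hs : g.IsSymm)
    (hL : ∀ u v : V, g (L v) u = g v (L u)) {i : Fin k} {e : V} (he : e ∈ D.block i)
    (hcyc : ∀ u ∈ D.block i, ∃ f : ℝ[X], u = aeval L f e) {X : Module.End ℝ V}
    (hX : X ∈ centraliserSo g L) : D.blockEnd i * X * D.blockEnd i = 0 := by
  have hXL : X * L = L * X := sub_eq_zero.mp hX.2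
  obtain ⟨h, hh⟩ := hcyc _ (D.blockEnd_mem i (X e))
  have key : ∀ a b : ℝ[X], g (X (aeval L a e)) (aeval L b e) =
      g (aeval L (a * h) e) (aeval L b e) := by
    intro a b
    have hb : D.blockEnd i (aeval L b e) = aeval L b e := by
      rw [D.blockEnd_apply_block (aeval_mem _ (D.invariant i) b he), if_pos rfl]
    rw [← hb, ← D.blockEnd_symm, ← D.blockEnd_symm]
    congr 2
    rw [← Module.End.mul_apply X, aeval_comm_of_comm hXL, Module.End.mul_apply,
      ← Module.End.mul_apply (D.blockEnd i), aeval_comm_of_comm (D.commute_blockEnd i).symm.eq,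
      Module.End.mul_apply, hh, ← Module.End.mul_apply (aeval L a), ← map_mul,
      D.blockEnd_apply_block (aeval_mem _ (D.invariant i) _ he), if_pos rfl]
  ext x
  refine hg.1 _ fun y => ?_
  rw [Module.End.mul_apply, Module.End.mul_apply, D.blockEnd_symm]
  obtain ⟨a, ha⟩ := hcyc _ (D.blockEnd_mem i x)
  obtain ⟨b, hb⟩ := hcyc _ (D.blockEnd_mem i y)
  have h1 := hX.1 (aeval L a e) (aeval L b e)
  rw [hs.eq (aeval L b e), key, key] at h1
  rw [ha, hb, key]
  have h2 : g (aeval L (b * h) e) (aeval L a e) = g (aeval L (a * h) e) (aeval L b e) := by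
    have htr : ∀ p q : ℝ[X], g (aeval L p e) (aeval L q e) = g e (aeval L (p * q) e) :=
      fun p q => by rw [aeval_symm hL, map_mul, Module.End.mul_apply]
    rw [htr, htr, mul_right_comm, mul_comm b a, mul_right_comm]
  linarith

/-- `R̂_ab` kills an operator carried by the blocks `(i, j)` and `(j, i)` unless `{i, j}` is
contained in `{a, b}`. -/
theorem rHat_eq_zero_of_support {i j a b : Fin k} (Z Z' : Module.End ℝ V) (Y : so g)
    (hY : (Y : Module.End ℝ V) =
      D.blockEnd i * Z * D.blockEnd j - D.blockEnd j * Z' * D.blockEnd i)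
    (h : ¬ ((i = a ∨ i = b) ∧ (j = a ∨ j = b))) : D.rHat a b Y = 0 := by
  rw [rHat_apply, hY, mul_sub, sub_mul]
  simp only [← mul_assoc, D.pairEnd_mul_blockEnd]
  simp only [mul_assoc, D.blockEnd_mul_pairEnd]
  by_cases hi : i = a ∨ i = b <;> by_cases hj : j = a ∨ j = b <;> simp_all

/-- The off-diagonal blocks `P_i X P_j + P_j X P_i` of an element `X` of the centraliser are
attained by `R_formal`. -/
theorem exists_rFormal_eq [FiniteDimensional ℝ V] (hg : g.Nondegenerate) (hs : g.IsSymm)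
    (hL : ∀ u v : V, g (L v) u = g v (L u))
    (hcyc : ∀ i, ∃ e ∈ D.block i, ∀ u ∈ D.block i, ∃ f : ℝ[X], u = aeval L f e)
    {X : Module.End ℝ V} (hX : X ∈ centraliserSo g L) {i j : Fin k} (hij : i < j) :
    ∃ Y : so g, D.rFormal Y =
      D.blockEnd j * X * D.blockEnd i + D.blockEnd i * X * D.blockEnd j := by
  have hXL : X * L = L * X := sub_eq_zero.mp hX.2
  obtain ⟨e₁, he₁, hcyc₁⟩ := hcyc i
  obtain ⟨e₂, he₂, hcyc₂⟩ := hcyc j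
  obtain ⟨h, hh⟩ := hcyc₁ _ (D.blockEnd_mem i (X e₂))
  have hidem : ∀ l, D.blockEnd l * D.blockEnd l = D.blockEnd l := fun l => by
    simpa [blockEnd] using D.pairEnd_mul_blockEnd l l l
  have hfix : D.blockEnd j e₂ = e₂ := by rw [D.blockEnd_apply_block he₂, if_pos rfl]
  set p := minpoly ℝ (D.pairOp i j) with hpdef
  have hker : ∀ (l : Fin k) (e : V), (∀ u ∈ D.block l, ∃ f : ℝ[X], u = aeval L f e) →
      ∀ f : ℝ[X], aeval L f e = 0 → ∀ v ∈ D.block l, aeval L f v = 0 := by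
    intro l e hc f hf v hv
    obtain ⟨q, rfl⟩ := hc v hv
    rw [← Module.End.mul_apply, ← map_mul, mul_comm, map_mul, Module.End.mul_apply, hf, map_zero]
  obtain ⟨f, φ, hφ⟩ := exists_polyDeriv_eq (L := L) (W := D.blockEnd i * X * D.blockEnd j)
    (Q := D.blockEnd j) (e₁ := e₁) (e₂ := e₂) (p := p) (h := h)
    (by
      rw [mul_assoc, ← (D.commute_blockEnd j).eq, ← mul_assoc, mul_assoc _ X, hXL, ← mul_assoc,
        ← (D.commute_blockEnd i).eq]
      simp only [mul_assoc])
    (D.commute_blockEnd j) (by rw [mul_assoc, hidem])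
    (fun u => hcyc₂ _ (D.blockEnd_mem j u)) hfix
    (D.aeval_minpoly_pairOp (Submodule.mem_sup_left he₁))
    (D.aeval_minpoly_pairOp (Submodule.mem_sup_right he₂))
    (fun f h₁ h₂ => D.minpoly_pairOp_dvd (hker i e₁ hcyc₁ f h₁) (hker j e₂ hcyc₂ f h₂))
    (by rw [Module.End.mul_apply, hfix, Module.End.mul_apply, hh])
  set Z : Module.End ℝ V := (φ ∘ₗ D.blockEnd j).smulRight (aeval L f e₁) with hZ
  have hPZP : D.blockEnd i * Z * D.blockEnd j = Z := by
    ext u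
    have h1 : D.blockEnd j (D.blockEnd j u) = D.blockEnd j u := DFunLike.congr_fun (hidem j) u
    have h2 : D.blockEnd i (aeval L f e₁) = aeval L f e₁ := by
      rw [D.blockEnd_apply_block (aeval_mem _ (D.invariant i) f he₁), if_pos rfl]
    simp [hZ, h1, h2]
  set Z' : Module.End ℝ V := g.leftAdjointOfNondegenerate hg Z with hZ'
  have hadj : ∀ u v, g (Z' u) v = g u (Z v) := g.isAdjointPairLeftAdjointOfNondegenerate hg Z
  have hadj' : ∀ u v, g (Z u) v = g u (Z' v) := fun u v => by
    rw [hs.eq, ← hadj, hs.eq]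
  let Y : so g := ⟨D.blockEnd i * Z * D.blockEnd j - D.blockEnd j * Z' * D.blockEnd i, by
    intro u v
    simp only [LinearMap.sub_apply, Module.End.mul_apply, map_sub, D.blockEnd_symm, hadj, hadj']
    ring⟩
  -- hence `R̂_ij` is the only summand of `R_formal` that does not kill `Y`
  have hother : ∀ a b : Fin k, a < b → ¬ (a = i ∧ b = j) → D.rHat a b Y = 0 := by
    intro a b hab hne
    refine D.rHat_eq_zero_of_support Z Z' Y rfl ?_
    rintro ⟨h1, h2⟩
    omega
  -- `Z'` is adjoint to `Z`, and `-P_j X P_i` is adjoint to `P_i X P_j`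
  have hW' : polyDeriv p L (D.blockEnd j * Z' * D.blockEnd i) =
      -(D.blockEnd j * X * D.blockEnd i) := by
    ext u
    rw [← sub_eq_zero]
    refine hg.1 _ fun v => ?_
    rw [map_sub, LinearMap.sub_apply, sub_eq_zero,
      polyDeriv_adjoint hL p (B := D.blockEnd i * Z * D.blockEnd j)
        (by intro u v; simp [D.blockEnd_symm, hadj]), hPZP, hφ]
    have hXs : ∀ a b : V, g (X a) b = - g a (X b) := fun a b => hX.1 b a
    simp [D.blockEnd_symm, hXs]
  refine ⟨Y, ?_⟩
  rw [rFormal_apply, Finset.sum_eq_single i, Finset.sum_eq_single j, rHat_apply]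
  · have hQ : D.pairEnd i j * (Y : Module.End ℝ V) * D.pairEnd i j = Y := by
      change D.pairEnd i j * (D.blockEnd i * Z * D.blockEnd j - D.blockEnd j * Z' * D.blockEnd i) *
        D.pairEnd i j = D.blockEnd i * Z * D.blockEnd j - D.blockEnd j * Z' * D.blockEnd i
      rw [mul_sub, sub_mul]
      simp only [← mul_assoc, D.pairEnd_mul_blockEnd]
      simp [mul_assoc, D.blockEnd_mul_pairEnd]
    rw [hQ]
    change polyDeriv p L (D.blockEnd i * Z * D.blockEnd j - D.blockEnd j * Z' * D.blockEnd i) = _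
    rw [map_sub, hW', hPZP, hφ]
    abel
  · intro b hb hne
    exact hother i b (Finset.mem_Ioi.mp hb) (by tauto)
  · intro hj; exact absurd (Finset.mem_Ioi.mpr hij) hj
  · intro a _ hne
    exact Finset.sum_eq_zero fun b hb => hother a b (Finset.mem_Ioi.mp hb) (by tauto)
  · intro hi; exact absurd (Finset.mem_univ i) hi

theorem range_rFormal [FiniteDimensional ℝ V] (hg : g.Nondegenerate) (hs : g.IsSymm)
    (hL : ∀ u v : V, g (L v) u = g v (L u))
    (hcyc : ∀ i, ∃ e ∈ D.block i, ∀ u ∈ D.block i, ∃ f : ℝ[X], u = aeval L f e) :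
    LinearMap.range D.rFormal = (centraliserSo g L).toSubmodule := by
  refine le_antisymm ?_ fun X hX => ?_
  · rintro _ ⟨Y, rfl⟩
    exact D.rFormal_mem hL Y
  · have hsum : X = ∑ i, ∑ j ∈ Finset.Ioi i, (D.blockEnd j * X * D.blockEnd i +
        D.blockEnd i * X * D.blockEnd j) := by
      rw [Finset.sum_sum_Ioi_add_eq_sum_sum_off_diag fun i j => D.blockEnd i * X * D.blockEnd j]
      have h1 : ∀ i, ∑ j ∈ ({i}ᶜ : Finset (Fin k)), D.blockEnd j * X * D.blockEnd i =
          ∑ j, D.blockEnd j * X * D.blockEnd i := by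
        intro i
        obtain ⟨e, he, hc⟩ := hcyc i
        rw [← Finset.sum_compl_add_sum {i}, Finset.sum_singleton,
          D.blockEnd_mul_mul_self hg hs hL he hc hX, add_zero]
      simp only [h1, ← Finset.sum_mul, ← Finset.mul_sum, sum_blockEnd, one_mul, mul_one]
    rw [hsum]
    refine sum_mem fun i _ => sum_mem fun j hj => ?_
    exact D.exists_rFormal_eq hg hs hL hcyc hX (Finset.mem_Ioi.mp hj)

end JordanDecomposition

/-! ### Jordan blocks and cyclic operators -/

section Model

theorem toMatrix_eq_of_apply {ι U : Type*} [Fintype ι] [DecidableEq ι] [AddCommGroup U]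
    [Module ℝ U] (b : Module.Basis ι ℝ U) (T : Module.End ℝ U) (M : Matrix ι ι ℝ)
    (h : ∀ j, T (b j) = ∑ i, M i j • b i) : LinearMap.toMatrix b b T = M := by
  have : T = Matrix.toLin b b M := b.ext fun j => by rw [h, Matrix.toLin_self]
  rw [this, LinearMap.toMatrix_toLin]

theorem map_aeval_of_conj {U U' : Type*} [AddCommGroup U] [Module ℝ U] [AddCommGroup U']
    [Module ℝ U'] {S : Module.End ℝ U} {T : Module.End ℝ U'} (ψ : U →ₗ[ℝ] U')
    (h : ∀ z, ψ (S z) = T (ψ z)) (f : ℝ[X]) (z : U) : ψ (aeval S f z) = aeval T f (ψ z) := by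
  induction f using polynomial_induction generalizing z with
  | hC a => simp
  | hadd p q hp hq => simp [hp, hq]
  | hX p hp => simp [hp, h]

theorem IsJordanBlock.of_conj {U U' : Type*} [AddCommGroup U] [Module ℝ U] [AddCommGroup U']
    [Module ℝ U'] {S : Module.End ℝ U} {T : Module.End ℝ U'} (ψ : U ≃ₗ[ℝ] U')
    (h : ∀ z, ψ (S z) = T (ψ z)) (hS : IsJordanBlock S) : IsJordanBlock T := by
  have key : ∀ {ι : Type} [Fintype ι] [DecidableEq ι] (b : Module.Basis ι ℝ U)
      (M : Matrix ι ι ℝ), LinearMap.toMatrix b b S = M →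
      LinearMap.toMatrix (b.map ψ) (b.map ψ) T = M := by
    intro ι _ _ b M hM
    refine toMatrix_eq_of_apply _ _ _ fun j => ?_
    have hS : S = Matrix.toLin b b M := by rw [← hM, Matrix.toLin_toMatrix]
    rw [Module.Basis.map_apply, ← h, hS, Matrix.toLin_self]
    simp
  rcases hS with ⟨n, hn, lam, b, hb⟩ | ⟨n, hn, x, y, b, hy, hb⟩
  · exact Or.inl ⟨n, hn, lam, b.map ψ, key b _ hb⟩
  · exact Or.inr ⟨n, hn, x, y, b.map ψ, hy, key b _ hb⟩

theorem aeval_lmul_apply {A : Type*} [CommRing A] [Algebra ℝ A] (x z : A) (f : ℝ[X]) :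
    aeval (Algebra.lmul ℝ A x) f z = aeval x f * z := by
  rw [Polynomial.aeval_algHom_apply]
  rfl

/-- In the cyclic module `ℝ[X]/(p)`, a family of `deg p` vectors that contains `1`, and on which
multiplication by the class of `X` acts through a matrix `M`, is a basis. -/
theorem exists_basis_adjoinRoot {ι : Type*} [Fintype ι] [DecidableEq ι] {p : ℝ[X]} (hp : p.Monic)
    (hcard : Fintype.card ι = p.natDegree) (e : ι → AdjoinRoot p) (M : Matrix ι ι ℝ) (i₀ : ι)
    (h₀ : e i₀ = 1) (hM : ∀ j, AdjoinRoot.root p * e j = ∑ i, M i j • e i) :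
    ∃ b : Module.Basis ι ℝ (AdjoinRoot p),
      LinearMap.toMatrix b b (Algebra.lmul ℝ (AdjoinRoot p) (AdjoinRoot.root p)) = M := by
  have hinv : ∀ v ∈ Submodule.span ℝ (Set.range e),
      Algebra.lmul ℝ (AdjoinRoot p) (AdjoinRoot.root p) v ∈ Submodule.span ℝ (Set.range e) := by
    intro v hv
    induction hv using Submodule.span_induction with
    | mem x hx =>
      obtain ⟨j, rfl⟩ := hx
      change AdjoinRoot.root p * e j ∈ _
      rw [hM]
      exact sum_mem fun i _ => Submodule.smul_mem _ _ (Submodule.subset_span ⟨i, rfl⟩)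
    | zero => simp
    | add x y _ _ hx hy => rw [map_add]; exact add_mem hx hy
    | smul a x _ hx => rw [map_smul]; exact Submodule.smul_mem _ _ hx
  have hspan : ⊤ ≤ Submodule.span ℝ (Set.range e) := by
    intro z _
    obtain ⟨f, rfl⟩ := AdjoinRoot.mk_surjective z
    have h1 : (1 : AdjoinRoot p) ∈ Submodule.span ℝ (Set.range e) :=
      h₀ ▸ Submodule.subset_span ⟨i₀, rfl⟩
    have := aeval_mem _ hinv f h1
    rwa [aeval_lmul_apply, mul_one, AdjoinRoot.aeval_eq] at this
  have hfin : Fintype.card ι = Module.finrank ℝ (AdjoinRoot p) := by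
    rw [hcard, (AdjoinRoot.powerBasis' hp).finrank, AdjoinRoot.powerBasis'_dim]
  refine ⟨basisOfTopLeSpanOfCardEqFinrank e hspan hfin, toMatrix_eq_of_apply _ _ _ fun j => ?_⟩
  simpa using hM j

/-- The contribution of the entries `1` above the diagonal of a Jordan matrix, when the `i`-th basis
vector is `G (n - 1 - i)` and `G n = 0`. -/
theorem sum_shift {M : Type*} [AddCommMonoid M] {n : ℕ} (G : ℕ → M) (hG : G n = 0) (j : Fin n) :
    (∑ i : Fin n, if (i : ℕ) + 1 = (j : ℕ) then G (n - 1 - i) else 0) = G (n - 1 - j + 1) := by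
  obtain ⟨j, hj⟩ := j
  rcases j with _ | j
  · simp [show n - 1 + 1 = n by omega, hG]
  · rw [Finset.sum_eq_single ⟨j, by omega⟩]
    · simp only [if_true]
      congr 1
      omega
    · intro b _ hb
      rw [if_neg]
      simpa [Fin.ext_iff] using hb
    · simp

/-- Multiplication by `X` on `ℝ[X]/((X - a)ⁿ)` has the matrix of a Jordan block in the basis of
powers of `X - a`. -/
theorem exists_basis_realJordan (a : ℝ) (n : ℕ) (hn : 0 < n) :
    ∃ b : Module.Basis (Fin n) ℝ (AdjoinRoot ((X - C a) ^ n)),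
      LinearMap.toMatrix b b (Algebra.lmul ℝ _ (AdjoinRoot.root ((X - C a) ^ n))) =
        realJordanMatrix a n := by
  set x := AdjoinRoot.root ((X - C a) ^ n) with hx
  set N := x - algebraMap ℝ _ a with hN
  have hNn : N ^ n = 0 := by
    have := AdjoinRoot.mk_self (f := (X - C a) ^ n)
    rw [map_pow, map_sub, AdjoinRoot.mk_X, AdjoinRoot.mk_C] at this
    exact this
  refine exists_basis_adjoinRoot ((monic_X_sub_C a).pow n) (by simp [natDegree_pow])
    (fun i : Fin n => N ^ (n - 1 - (i : ℕ))) _ ⟨n - 1, by omega⟩ (by simp) fun j => ?_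
  have hterm : ∀ i : Fin n, realJordanMatrix a n i j • N ^ (n - 1 - (i : ℕ)) =
      (if i = j then a • N ^ (n - 1 - (i : ℕ)) else 0) +
        (if (i : ℕ) + 1 = (j : ℕ) then N ^ (n - 1 - (i : ℕ)) else 0) := by
    intro i
    rw [realJordanMatrix, Matrix.of_apply]
    by_cases h1 : i = j
    · subst h1; simp
    · by_cases h2 : (i : ℕ) + 1 = (j : ℕ) <;> simp [h1, h2]
  rw [Finset.sum_congr rfl fun i _ => hterm i, Finset.sum_add_distrib,
    sum_shift (fun m => N ^ m) hNn j, Finset.sum_ite_eq' Finset.univ j, if_pos (Finset.mem_univ _),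
    ← hx, Algebra.smul_def, pow_succ']
  rw [hN]
  ring

/-- Jordan–Chevalley decomposition of an element `x` of a commutative algebra that satisfies
`((x - a)² + b²)ⁿ = 0`: the semisimple part is `a + bJ` with `J² = -1`. It is obtained by Newton
approximation. -/
theorem exists_sq_eq_neg_one {A : Type*} [CommRing A] [Algebra ℝ A] (x : A) (a b : ℝ)
    (hb : b ≠ 0) (n : ℕ)
    (h : ((x - algebraMap ℝ A a) ^ 2 + algebraMap ℝ A b ^ 2) ^ n = 0) :
    ∃ J N : A, J * J = -1 ∧ x = algebraMap ℝ A a + algebraMap ℝ A b * J + N ∧ N ^ n = 0 := by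
  set P : ℝ[X] := (X - C a) ^ 2 + C b ^ 2 with hP
  have hu : ∀ c : ℝ, c ≠ 0 → IsUnit (algebraMap ℝ A c) := fun c hc =>
    (isUnit_iff_ne_zero.mpr hc).map _
  have hnil : IsNilpotent (aeval x P) := ⟨n, by simpa [hP] using h⟩
  have hunit : IsUnit (aeval x (derivative P)) := by
    have h1 : aeval x (derivative P) = 2 * (x - algebraMap ℝ A a) := by
      simp [hP, derivative_pow, map_ofNat (algebraMap ℝ A)]
    have h2 : (2 * (x - algebraMap ℝ A a)) ^ 2 =
        algebraMap ℝ A (-(4 * b ^ 2)) + 4 * aeval x P := by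
      simp [hP, map_ofNat (algebraMap ℝ A)]
      ring
    rw [h1, ← isUnit_pow_iff two_ne_zero, h2]
    exact IsNilpotent.isUnit_add_left_of_commute ((Commute.all _ _).isNilpotent_mul_left hnil)
      (hu _ (by simpa using hb)) (Commute.all _ _)
  obtain ⟨s, ⟨hs, hs0⟩, -⟩ := existsUnique_nilpotent_sub_and_aeval_eq_zero hnil hunit
  have hs1 : (s - algebraMap ℝ A a) ^ 2 = - algebraMap ℝ A b ^ 2 := by
    have : (s - algebraMap ℝ A a) ^ 2 + algebraMap ℝ A b ^ 2 = 0 := by simpa [hP] using hs0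
    linear_combination this
  have hbb : algebraMap ℝ A b * algebraMap ℝ A b⁻¹ = 1 := by
    rw [← map_mul, mul_inv_cancel₀ hb, map_one]
  set J := algebraMap ℝ A b⁻¹ * (s - algebraMap ℝ A a) with hJ
  have hbJ : algebraMap ℝ A b * J = s - algebraMap ℝ A a := by
    rw [hJ, ← mul_assoc, hbb, one_mul]
  have hJJ : J * J = -1 := by
    have : J * J = algebraMap ℝ A b⁻¹ ^ 2 * (s - algebraMap ℝ A a) ^ 2 := by rw [hJ]; ring
    rw [this, hs1]
    linear_combination (-(algebraMap ℝ A b * algebraMap ℝ A b⁻¹) - 1) * hbb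
  refine ⟨J, x - s, hJJ, by rw [hbJ]; ring, ?_⟩
  -- `(x - a)² + b² = (x - s)(2bJ + (x - s))`, and the second factor is a unit
  have hfac : (x - algebraMap ℝ A a) ^ 2 + algebraMap ℝ A b ^ 2 =
      (x - s) * (algebraMap ℝ A (2 * b) * J + (x - s)) := by
    have : (x - algebraMap ℝ A a) = algebraMap ℝ A b * J + (x - s) := by rw [hbJ]; ring
    rw [this, map_mul, map_ofNat]
    linear_combination (algebraMap ℝ A b) ^ 2 * hJJ
  have hJu : IsUnit J := IsUnit.of_mul_eq_one (-J) (by linear_combination -hJJ)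
  have hunit' : IsUnit (algebraMap ℝ A (2 * b) * J + (x - s)) :=
    IsNilpotent.isUnit_add_left_of_commute hs ((hu _ (by simpa using hb)).mul hJu)
      (Commute.all _ _)
  rw [hfac, mul_pow] at h
  exact ((hunit'.pow n).mul_left_eq_zero).mp h

theorem monic_quadratic (a b : ℝ) : ((X - C a) ^ 2 + C b ^ 2 : ℝ[X]).Monic ∧
    ((X - C a) ^ 2 + C b ^ 2 : ℝ[X]).natDegree = 2 := by
  have h1 : ((X - C a) ^ 2 : ℝ[X]).Monic := (monic_X_sub_C a).pow 2
  have h2 : ((X - C a) ^ 2 : ℝ[X]).natDegree = 2 := by simp [natDegree_pow]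
  have hlt : (C b ^ 2 : ℝ[X]).degree < ((X - C a) ^ 2 : ℝ[X]).degree := by
    rw [degree_eq_natDegree h1.ne_zero, h2, ← C_pow]
    exact lt_of_le_of_lt degree_C_le (by norm_num)
  refine ⟨h1.add_of_left hlt, ?_⟩
  rw [natDegree_eq_of_degree_eq (degree_add_eq_left_of_degree_lt hlt), h2]

/-- Multiplication by `X` on `ℝ[X]/(((X - a)² + b²)ⁿ)` has the matrix of a real Jordan block. The
basis consists of the elements `N ^ m` and `-J N ^ m`, where `X = a + bJ + N` is the
Jordan–Chevalley decomposition. -/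
theorem exists_basis_complexJordan (a b : ℝ) (hb : b ≠ 0) (n : ℕ) (hn : 0 < n) :
    ∃ B : Module.Basis (Fin n × Fin 2) ℝ (AdjoinRoot (((X - C a) ^ 2 + C b ^ 2) ^ n)),
      LinearMap.toMatrix B B
        (Algebra.lmul ℝ _ (AdjoinRoot.root (((X - C a) ^ 2 + C b ^ 2) ^ n))) =
        complexJordanMatrix a b n := by
  obtain ⟨J, N, hJ, hx, hN⟩ := exists_sq_eq_neg_one
    (AdjoinRoot.root (((X - C a) ^ 2 + C b ^ 2) ^ n)) a b hb n (by
      have := AdjoinRoot.mk_self (f := ((X - C a) ^ 2 + C b ^ 2) ^ n)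
      rw [map_pow, map_add, map_pow, map_pow, map_sub, AdjoinRoot.mk_X, AdjoinRoot.mk_C,
        AdjoinRoot.mk_C] at this
      exact this)
  let G : Fin 2 → ℕ → AdjoinRoot (((X - C a) ^ 2 + C b ^ 2) ^ n) :=
    fun s m => (![1, -J] : Fin 2 → _) s * N ^ m
  refine exists_basis_adjoinRoot ((monic_quadratic a b).1.pow n)
    (by rw [natDegree_pow, (monic_quadratic a b).2]; simp)
    (fun i => G i.2 (n - 1 - i.1)) _ (⟨n - 1, by omega⟩, 0) (by simp [G]) fun j => ?_
  obtain ⟨j, s⟩ := j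
  have hterm : ∀ i : Fin n,
      ∑ r, complexJordanMatrix a b n (i, r) (j, s) • G r (n - 1 - (i : ℕ)) =
      (if i = j then ∑ r, (!![a, b; -b, a] : Matrix (Fin 2) (Fin 2) ℝ) r s •
        G r (n - 1 - (i : ℕ)) else 0) +
        (if (i : ℕ) + 1 = (j : ℕ) then G s (n - 1 - (i : ℕ)) else 0) := by
    intro i
    simp only [complexJordanMatrix, Matrix.of_apply]
    by_cases h1 : i = j
    · subst h1; simp
    · by_cases h2 : (i : ℕ) + 1 = (j : ℕ)
      · simp [h1, h2, Matrix.one_apply]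
      · simp [h1, h2]
  rw [Fintype.sum_prod_type, Finset.sum_congr rfl fun i _ => hterm i, Finset.sum_add_distrib,
    sum_shift (G s) (by simp [G, hN]) j, Finset.sum_ite_eq' Finset.univ j,
    if_pos (Finset.mem_univ _), hx]
  fin_cases s
  · simp [G, Algebra.smul_def, pow_succ']
    ring
  · simp [G, Algebra.smul_def, pow_succ']
    linear_combination (-AdjoinRoot.of _ b * N ^ (n - 1 - (j : ℕ))) * hJ

theorem eq_linear_or_quadratic {q : ℝ[X]} (hq : Irreducible q) (hmon : q.Monic) :
    (∃ a : ℝ, q = X - C a) ∨ ∃ a b : ℝ, b ≠ 0 ∧ q = (X - C a) ^ 2 + C b ^ 2 := by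
  obtain ⟨z, hz⟩ : ∃ z : ℂ, aeval z q = 0 :=
    IsAlgClosed.exists_aeval_eq_zero _ q (degree_pos_of_irreducible hq).ne'
  by_cases him : z.im = 0
  · left
    refine ⟨z.re, ?_⟩
    have hz' : z = algebraMap ℝ ℂ z.re := Complex.ext (by simp) (by simp [him])
    rw [hz', aeval_algebraMap_apply, map_eq_zero] at hz
    have hd : X - C z.re ∣ q := dvd_iff_isRoot.mpr (by simpa using hz)
    exact (eq_of_monic_of_associated (monic_X_sub_C _) hmon
      ((irreducible_X_sub_C _).associated_of_dvd hq hd)).symm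
  · right
    refine ⟨z.re, z.im, him, ?_⟩
    have hd := Polynomial.quadratic_dvd_of_aeval_eq_zero_im_ne_zero q hz him
    have he : (X ^ 2 - C (2 * z.re) * X + C (‖z‖ ^ 2) : ℝ[X]) = (X - C z.re) ^ 2 + C z.im ^ 2 := by
      rw [← Complex.normSq_eq_norm_sq, Complex.normSq_apply]
      simp only [map_mul, map_add, map_ofNat]
      ring
    rw [he] at hd
    have hnu : ¬ IsUnit ((X - C z.re) ^ 2 + C z.im ^ 2 : ℝ[X]) := fun hu => by
      have := natDegree_eq_zero_of_isUnit hu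
      rw [(monic_quadratic _ _).2] at this
      omega
    exact (eq_of_monic_of_associated (monic_quadratic _ _).1 hmon
      (((hq.dvd_iff.mp hd).resolve_left hnu).symm)).symm

/-- A cyclic operator whose annihilator is a power of an irreducible polynomial is a Jordan
block. -/
theorem isJordanBlock_of_cyclic {U : Type*} [AddCommGroup U] [Module ℝ U] (T : Module.End ℝ U)
    (v : U) {q : ℝ[X]} (hq : Irreducible q) (hmon : q.Monic) {m : ℕ} (hm : 0 < m)
    (hann : ∀ f : ℝ[X], aeval T f v = 0 ↔ q ^ m ∣ f) (hcyc : ∀ u, ∃ f : ℝ[X], u = aeval T f v) :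
    IsJordanBlock T := by
  have hT : aeval T (q ^ m) = 0 := by
    ext u
    obtain ⟨f, rfl⟩ := hcyc u
    rw [← Module.End.mul_apply, ← map_mul, LinearMap.zero_apply, hann]
    exact dvd_mul_right _ _
  let ψ : AdjoinRoot (q ^ m) →ₗ[ℝ] U :=
    (LinearMap.applyₗ v) ∘ₗ (Ideal.Quotient.liftₐ (Ideal.span {q ^ m}) (aeval T)
      fun a ha => by
        obtain ⟨c, rfl⟩ := Ideal.mem_span_singleton.mp ha
        rw [map_mul, hT, zero_mul]).toLinearMap
  have hψ : ∀ f, ψ (AdjoinRoot.mk _ f) = aeval T f v := fun f => rfl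
  let Ψ : AdjoinRoot (q ^ m) ≃ₗ[ℝ] U := LinearEquiv.ofBijective ψ (by
    constructor
    · rw [injective_iff_map_eq_zero]
      intro z hz
      obtain ⟨f, rfl⟩ := AdjoinRoot.mk_surjective z
      rw [hψ, hann] at hz
      exact AdjoinRoot.mk_eq_zero.mpr hz
    · intro u
      obtain ⟨f, rfl⟩ := hcyc u
      exact ⟨AdjoinRoot.mk _ f, hψ f⟩)
  have hconj : ∀ z, Ψ (Algebra.lmul ℝ _ (AdjoinRoot.root (q ^ m)) z) = T (Ψ z) := by
    intro z
    obtain ⟨f, rfl⟩ := AdjoinRoot.mk_surjective z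
    change ψ (AdjoinRoot.root _ * _) = T (ψ _)
    rw [← AdjoinRoot.mk_X, ← map_mul, hψ, hψ, map_mul, aeval_X, Module.End.mul_apply]
  refine IsJordanBlock.of_conj Ψ hconj ?_
  rcases eq_linear_or_quadratic hq hmon with ⟨a, rfl⟩ | ⟨a, b, hb, rfl⟩
  · obtain ⟨B, hB⟩ := exists_basis_realJordan a m hm
    exact Or.inl ⟨m, hm, a, B, hB⟩
  · obtain ⟨B, hB⟩ := exists_basis_complexJordan a b hb m hm
    exact Or.inr ⟨m, hm, a, b, B, hb, hB⟩

/-- A Jordan block is a cyclic operator: its matrix is that of multiplication by `X` on a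
quotient of `ℝ[X]`, and hence it is conjugate to the latter. -/
theorem IsJordanBlock.exists_cyclic {U : Type*} [AddCommGroup U] [Module ℝ U]
    {T : Module.End ℝ U} (hT : IsJordanBlock T) :
    ∃ e : U, ∀ u, ∃ f : ℝ[X], u = aeval T f e := by
  have key : ∀ {ι : Type} [Fintype ι] [DecidableEq ι] (p : ℝ[X])
      (B : Module.Basis ι ℝ (AdjoinRoot p)) (b : Module.Basis ι ℝ U),
      LinearMap.toMatrix B B (Algebra.lmul ℝ _ (AdjoinRoot.root p)) =
        LinearMap.toMatrix b b T → ∃ e : U, ∀ u, ∃ f : ℝ[X], u = aeval T f e := by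
    intro ι _ _ p B b h
    let Ψ : AdjoinRoot p ≃ₗ[ℝ] U := B.equiv b (Equiv.refl _)
    have hB : ∀ j, Ψ (B j) = b j := fun j => by simp [Ψ]
    have hconj : Ψ.toLinearMap ∘ₗ (Algebra.lmul ℝ _ (AdjoinRoot.root p)) =
        T ∘ₗ Ψ.toLinearMap := by
      refine B.ext fun j => ?_
      rw [LinearMap.comp_apply, LinearMap.comp_apply, LinearEquiv.coe_coe, hB,
        ← Matrix.toLin_toMatrix B B (Algebra.lmul ℝ _ (AdjoinRoot.root p)),
        ← Matrix.toLin_toMatrix b b T, Matrix.toLin_self, Matrix.toLin_self, h]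
      simp [hB]
    refine ⟨Ψ 1, fun u => ?_⟩
    obtain ⟨f, hf⟩ := AdjoinRoot.mk_surjective (Ψ.symm u)
    refine ⟨f, ?_⟩
    have := map_aeval_of_conj Ψ.toLinearMap (fun z => LinearMap.congr_fun hconj z) f 1
    rw [aeval_lmul_apply, mul_one, AdjoinRoot.aeval_eq, hf] at this
    simpa using this
  rcases hT with ⟨n, hn, lam, b, hb⟩ | ⟨n, hn, x, y, b, hy, hb⟩
  · obtain ⟨B, hB⟩ := exists_basis_realJordan lam n hn
    exact key _ B b (hB.trans hb.symm)
  · obtain ⟨B, hB⟩ := exists_basis_complexJordan x y hy n hn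
    exact key _ B b (hB.trans hb.symm)

end Model

/-! ### Existence of an orthogonal decomposition into Jordan blocks -/

section Existence

variable {V : Type*} [AddCommGroup V] [Module ℝ V] {g : LinearMap.BilinForm ℝ V}
  {L : Module.End ℝ V}

/-- In `ℝ[X]/(q ^ m)` every non-zero ideal contains the class of `q ^ (m - 1)`. -/
theorem exists_combination_eq_pow {q : ℝ[X]} (hq : Irreducible q) (m : ℕ) {f : ℝ[X]}
    (hf : ¬ q ^ (m + 1) ∣ f) : ∃ c t : ℝ[X], c * f + t * q ^ (m + 1) = q ^ m := by
  obtain ⟨d, hd⟩ := (IsPrincipalIdealRing.principal (Ideal.span {f, q ^ (m + 1)})).principal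
  have hdf : d ∣ f := by
    rw [← Ideal.mem_span_singleton, Ideal.span, ← hd]
    exact Ideal.subset_span (by simp)
  have hdq : d ∣ q ^ (m + 1) := by
    rw [← Ideal.mem_span_singleton, Ideal.span, ← hd]
    exact Ideal.subset_span (by simp)
  obtain ⟨i, hi, hass⟩ := (dvd_prime_pow hq.prime _).mp hdq
  have hne : i ≠ m + 1 := by
    rintro rfl
    exact hf (hass.symm.dvd.trans hdf)
  have hmem : q ^ m ∈ Ideal.span {f, q ^ (m + 1)} := by
    rw [hd, ← Ideal.span, Ideal.mem_span_singleton]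
    exact hass.dvd.trans (pow_dvd_pow q (by omega))
  exact Ideal.mem_span_pair.mp hmem

/-- Polarization of the symmetric form `g (S x, y)`. -/
theorem exists_diagonal_ne_zero (hs : g.IsSymm) {S : Module.End ℝ V}
    (hS : ∀ u v : V, g (S v) u = g v (S u)) {W : Submodule ℝ V} {x y : V} (hx : x ∈ W)
    (hy : y ∈ W) (hxy : g (S x) y ≠ 0) : ∃ v ∈ W, g (S v) v ≠ 0 := by
  by_contra! h
  have h1 := h (x + y) (W.add_mem hx hy)
  simp only [map_add, LinearMap.add_apply, h x hx, h y hy] at h1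
  have h2 : g (S y) x = g (S x) y := by rw [hS, hs.eq]
  exact hxy (by linarith)

/-- Let `q ^ (m + 1)` be the exact power of an irreducible `q` in the minimal polynomial of `L` on
`W`. If `q(L) ^ (m + 1) v = 0` and `g (q(L) ^ m v, f(L) v) ≠ 0` for some `f`, then `v` generates a
non-degenerate cyclic subspace, since every non-zero submodule of `ℝ[L] v` contains `q(L) ^ m v`. -/
theorem exists_jordan_subspace [FiniteDimensional ℝ V] (hs : g.IsSymm)
    (hL : ∀ u v : V, g (L v) u = g v (L u)) {W : Submodule ℝ V} (hW : W ≠ ⊥)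
    (hinv : ∀ v ∈ W, L v ∈ W) (hnd : ∀ u ∈ W, (∀ v ∈ W, g u v = 0) → u = 0) :
    ∃ U : Submodule ℝ V, U ≤ W ∧ U ≠ ⊥ ∧ (∀ u ∈ U, (∀ v ∈ U, g u v = 0) → u = 0) ∧
      ∃ h : ∀ v ∈ U, L v ∈ U, IsJordanBlock (L.restrict h) := by
  have hcoe : ∀ (U : Submodule ℝ V) (h : ∀ v ∈ U, L v ∈ U) (f : ℝ[X]) (u : U),
      ((aeval (L.restrict h) f u : U) : V) = aeval L f (u : V) := fun U h f u =>
    map_aeval_of_conj U.subtype (fun _ => rfl) f u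
  set p := minpoly ℝ (L.restrict hinv) with hpdef
  have hp0 : p ≠ 0 := minpoly.ne_zero (Algebra.IsIntegral.isIntegral _)
  have hpW : ∀ v ∈ W, aeval L p v = 0 := fun v hv => by
    have := hcoe W hinv p ⟨v, hv⟩
    simpa [hpdef] using this.symm
  have hpdvd : ∀ f : ℝ[X], (∀ v ∈ W, aeval L f v = 0) → p ∣ f := fun f hf => by
    refine minpoly.dvd _ _ ?_
    ext v
    rw [hcoe, hf v v.2]
    rfl
  have hunit : ¬ IsUnit p := by
    intro hu
    obtain ⟨v, hv, hv0⟩ := W.ne_bot_iff.mp hW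
    obtain ⟨c, hc⟩ := hu.exists_left_inv
    apply hv0
    have : aeval L (c * p) v = 0 := by rw [map_mul, Module.End.mul_apply, hpW v hv, map_zero]
    simpa [hc] using this
  obtain ⟨q, hmon, hq, hqp⟩ := Polynomial.exists_monic_irreducible_factor p hunit
  obtain ⟨r, hr, hqr⟩ :=
    (FiniteMultiplicity.of_not_isUnit hq.not_isUnit hp0).exists_eq_pow_mul_and_not_dvd
  obtain ⟨m, hm⟩ : ∃ m, multiplicity q p = m + 1 := by
    refine Nat.exists_eq_succ_of_ne_zero fun h0 => ?_
    rw [h0, pow_zero, one_mul] at hr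
    exact hqr (hr ▸ hqp)
  rw [hm] at hr
  -- `q ^ m * r` does not annihilate `W`, hence the form `g (q(L) ^ m r(L) x, y)` is not zero
  have hnot : ¬ p ∣ q ^ m * r := by
    intro hd
    rw [hr, pow_succ] at hd
    have hr0 : q ^ m * r ≠ 0 := by
      rintro h0
      apply hp0
      rw [hr, pow_succ, mul_right_comm, h0, zero_mul]
    have : q ^ m * r * q ∣ q ^ m * r * 1 := by rwa [mul_one, mul_right_comm]
    exact hq.not_isUnit (isUnit_of_dvd_one ((mul_dvd_mul_iff_left hr0).mp this))
  obtain ⟨x, hx, hx0⟩ : ∃ x ∈ W, aeval L (q ^ m * r) x ≠ 0 := by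
    by_contra! h
    exact hnot (hpdvd _ h)
  obtain ⟨y, hy, hxy⟩ : ∃ y ∈ W, g (aeval L (q ^ m * r) x) y ≠ 0 := by
    by_contra! h
    exact hx0 (hnd _ (aeval_mem W hinv _ hx) h)
  obtain ⟨v₀, hv₀, hne⟩ := exists_diagonal_ne_zero hs (aeval_symm hL _) hx hy hxy
  -- `v = r(L) v₀` lies in the `q`-primary part; with `f` inverse to `r` modulo `q`, the pairing of
  -- `q(L) ^ m v` with `f(L) v` is `g (q(L) ^ m r(L) v₀, v₀)`, because `p(L) v₀ = 0`
  obtain ⟨f, t, hft⟩ := exists_combination_eq_pow hq 0 (f := r) (by simpa using hqr)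
  rw [zero_add, pow_one, pow_zero] at hft
  set v := aeval L r v₀ with hv
  have hvq : aeval L (q ^ (m + 1)) v = 0 := by
    rw [hv, ← Module.End.mul_apply, ← map_mul, ← hr, hpW v₀ hv₀]
  have hkey : g (aeval L (q ^ m) v) (aeval L f v) ≠ 0 := by
    have : g (aeval L (q ^ m) v) (aeval L f v) = g (aeval L (q ^ m * r) v₀) v₀ := by
      have hpol : q ^ m * r * (f * r) = q ^ m * r - t * p := by
        rw [hr]
        linear_combination (q ^ m * r) * hft
      rw [hv, ← Module.End.mul_apply (aeval L (q ^ m)), ← Module.End.mul_apply (aeval L f),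
        ← map_mul, ← map_mul, aeval_symm hL, ← Module.End.mul_apply, ← map_mul, hpol, map_sub,
        map_mul _ t, LinearMap.sub_apply, Module.End.mul_apply (aeval L t), hpW v₀ hv₀, map_zero,
        sub_zero, aeval_symm hL]
    rwa [this]
  have hcomb : ∀ a : ℝ[X], ¬ q ^ (m + 1) ∣ a →
      ∃ c : ℝ[X], aeval L c (aeval L a v) = aeval L (q ^ m) v := by
    intro a ha
    obtain ⟨c, t, hct⟩ := exists_combination_eq_pow hq m ha
    refine ⟨c, ?_⟩
    rw [← hct, map_add, map_mul, map_mul, LinearMap.add_apply, Module.End.mul_apply,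
      Module.End.mul_apply, hvq, map_zero, add_zero]
  have hann : ∀ a : ℝ[X], aeval L a v = 0 ↔ q ^ (m + 1) ∣ a := by
    intro a
    constructor
    · intro ha
      by_contra hd
      obtain ⟨c, hc⟩ := hcomb a hd
      rw [ha, map_zero] at hc
      rw [← hc] at hkey
      simp at hkey
    · rintro ⟨c, rfl⟩
      rw [mul_comm, map_mul, Module.End.mul_apply, hvq, map_zero]
  let U : Submodule ℝ V := LinearMap.range
    ((LinearMap.applyₗ v) ∘ₗ (aeval L : ℝ[X] →ₐ[ℝ] Module.End ℝ V).toLinearMap)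
  have hU : ∀ u, u ∈ U ↔ ∃ a : ℝ[X], u = aeval L a v := fun u =>
    ⟨fun ⟨a, ha⟩ => ⟨a, ha.symm⟩, fun ⟨a, ha⟩ => ⟨a, ha.symm⟩⟩
  have hvU : v ∈ U := (hU v).mpr ⟨1, by simp⟩
  have hUinv : ∀ u ∈ U, L u ∈ U := by
    intro u hu
    obtain ⟨a, rfl⟩ := (hU u).mp hu
    exact (hU _).mpr ⟨X * a, by simp⟩
  refine ⟨U, ?_, ?_, ?_, hUinv, ?_⟩
  · intro u hu
    obtain ⟨a, rfl⟩ := (hU u).mp hu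
    exact aeval_mem W hinv a (aeval_mem W hinv r hv₀)
  · refine U.ne_bot_iff.mpr ⟨v, hvU, fun h0 => ?_⟩
    rw [h0] at hkey
    simp at hkey
  · intro u hu hperp
    obtain ⟨a, rfl⟩ := (hU u).mp hu
    by_contra hne
    obtain ⟨c, hc⟩ := hcomb a (fun hd => hne ((hann a).mpr hd))
    apply hkey
    rw [← hc, aeval_symm hL, ← Module.End.mul_apply (aeval L c), ← map_mul]
    exact hperp _ ((hU _).mpr ⟨_, rfl⟩)
  · refine isJordanBlock_of_cyclic (L.restrict hUinv) ⟨v, hvU⟩ hq hmon (Nat.succ_pos m) ?_ ?_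
    · intro a
      rw [← hann, ← hcoe U hUinv a ⟨v, hvU⟩, Submodule.coe_eq_zero]
    · rintro ⟨u, hu⟩
      obtain ⟨a, rfl⟩ := (hU u).mp hu
      exact ⟨a, Subtype.ext (hcoe U hUinv a ⟨v, hvU⟩).symm⟩

/-- Induction on the dimension: a non-degenerate Jordan subspace splits off together with its
orthogonal complement. -/
theorem exists_orthogonal_blocks [FiniteDimensional ℝ V] (hs : g.IsSymm)
    (hL : ∀ u v : V, g (L v) u = g v (L u)) (n : ℕ) : ∀ W : Submodule ℝ V,
    Module.finrank ℝ W = n → (∀ v ∈ W, L v ∈ W) →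
    (∀ u ∈ W, (∀ v ∈ W, g u v = 0) → u = 0) →
    ∃ (k : ℕ) (B : Fin k → Submodule ℝ V), ⨆ i, B i = W ∧
      (∀ i j, i ≠ j → ∀ u ∈ B i, ∀ v ∈ B j, g u v = 0) ∧
      (∀ i, ∀ u ∈ B i, (∀ v ∈ B i, g u v = 0) → u = 0) ∧
      ∀ i, ∃ h : ∀ v ∈ B i, L v ∈ B i, IsJordanBlock (L.restrict h) := by
  induction n using Nat.strong_induction_on with
  | _ n ih =>
    intro W hn hinv hnd
    by_cases hW : W = ⊥
    · exact ⟨0, Fin.elim0, by simp [hW], fun i => i.elim0, fun i => i.elim0, fun i => i.elim0⟩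
    obtain ⟨U, hUW, hU0, hUnd, hUinv, hUJ⟩ := exists_jordan_subspace hs hL hW hinv hnd
    let W' : Submodule ℝ V := W ⊓ g.orthogonal U
    have hcompl : IsCompl U (g.orthogonal U) := by
      refine LinearMap.BilinForm.isCompl_orthogonal_of_restrict_nondegenerate hs.isRefl ?_
      have hsep : ∀ u : U, (∀ v : U, g u v = 0) → u = 0 := fun u hu =>
        Subtype.ext (hUnd u u.2 fun v hv => hu ⟨v, hv⟩)
      exact ⟨hsep, fun u hu => hsep u fun v => by rw [hs.eq]; exact hu v⟩
    have hperp : ∀ u ∈ U, ∀ w ∈ W', g u w = 0 := fun u hu w hw => hw.2 u hu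
    have hsup : U ⊔ W' = W := by
      refine le_antisymm (sup_le hUW inf_le_left) fun w hw => ?_
      obtain ⟨u, hu, w', hw', rfl⟩ := Submodule.mem_sup.mp
        (show w ∈ U ⊔ g.orthogonal U by rw [hcompl.sup_eq_top]; trivial)
      refine Submodule.add_mem_sup hu ⟨?_, hw'⟩
      simpa using W.sub_mem hw (hUW hu)
    have hlt : W' < W := by
      refine lt_of_le_of_ne inf_le_left fun heq => hU0 ?_
      rw [eq_bot_iff, ← hcompl.inf_eq_bot]
      exact le_inf le_rfl fun u hu => (heq ▸ hUW hu : u ∈ W').2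
    have hW'inv : ∀ v ∈ W', L v ∈ W' := fun v hv =>
      ⟨hinv v hv.1, fun u hu => by
        change g u (L v) = 0
        rw [← hL]
        exact hperp _ (hUinv u hu) v hv⟩
    have hW'nd : ∀ u ∈ W', (∀ v ∈ W', g u v = 0) → u = 0 := by
      intro u hu h
      refine hnd u hu.1 fun v hv => ?_
      rw [← hsup] at hv
      obtain ⟨a, ha, b, hb, rfl⟩ := Submodule.mem_sup.mp hv
      rw [map_add, h b hb, hs.eq, hperp a ha u hu, add_zero]
    obtain ⟨k, B, hB, horth, hBnd, hBJ⟩ := ih _ (hn ▸ Submodule.finrank_lt_finrank_of_lt hlt) W'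
      rfl hW'inv hW'nd
    have hBW : ∀ i, B i ≤ W' := fun i => hB ▸ le_iSup B i
    refine ⟨k + 1, Fin.cons U B, ?_, ?_, ?_, ?_⟩
    · rw [← hsup, ← hB]
      refine le_antisymm (iSup_le fun i => ?_) (sup_le ?_ (iSup_le fun i => ?_))
      · refine Fin.cases ?_ (fun i => ?_) i
        · exact le_sup_left
        · exact le_sup_of_le_right (le_iSup B i)
      · exact le_iSup (Fin.cons U B : Fin (k + 1) → Submodule ℝ V) 0
      · exact le_iSup (Fin.cons U B : Fin (k + 1) → Submodule ℝ V) i.succ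
    · intro i j
      refine Fin.cases ?_ (fun i => ?_) i <;> refine Fin.cases ?_ (fun j => ?_) j
      · intro h; exact absurd rfl h
      · intro _ u hu v hv
        exact hperp u hu v (hBW j hv)
      · intro _ u hu v hv
        rw [hs.eq]
        exact hperp v hv u (hBW i hu)
      · intro h
        exact horth i j fun hij => h (hij ▸ rfl)
    · intro i
      refine Fin.cases ?_ (fun i => ?_) i
      · exact hUnd
      · exact hBnd i
    · intro i
      refine Fin.cases ?_ (fun i => ?_) i
      · exact ⟨hUinv, hUJ⟩
      · exact hBJ i

theorem exists_jordanDecomposition [FiniteDimensional ℝ V] (hg : g.Nondegenerate)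
    (hs : g.IsSymm) (hL : ∀ u v : V, g (L v) u = g v (L u)) :
    ∃ k : ℕ, Nonempty (JordanDecomposition g L k) := by
  obtain ⟨k, B, hB, horth, hnd, hJ⟩ := exists_orthogonal_blocks hs hL _ ⊤ rfl (by simp)
    fun u _ h => hg.1 u fun v => h v trivial
  refine ⟨k, ⟨B, ?_, horth, fun i => (hJ i).1, fun i => (hJ i).2⟩⟩
  rw [DirectSum.isInternal_submodule_iff_iSupIndep_and_iSup_eq_top]
  refine ⟨fun i => ?_, hB⟩
  rw [Submodule.disjoint_def]
  intro x hx hx'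
  have hle : ⨆ j, ⨆ (_ : j ≠ i), B j ≤ g.orthogonal (B i) :=
    iSup_le fun j => iSup_le fun hj v hv u hu => horth i j hj.symm u hu v hv
  refine hnd i x hx fun v hv => ?_
  rw [hs.eq]
  exact hle hx' v hv

end Existence

/-! ### Berger algebras -/

/-- Each block of a Jordan decomposition is a cyclic `ℝ[L]`-module. -/
theorem JordanDecomposition.exists_cyclic {V : Type*} [AddCommGroup V] [Module ℝ V]
    {g : LinearMap.BilinForm ℝ V} {L : Module.End ℝ V} {k : ℕ} (D : JordanDecomposition g L k)
    (i : Fin k) : ∃ e ∈ D.block i, ∀ u ∈ D.block i, ∃ f : ℝ[X], u = aeval L f e := by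
  obtain ⟨e, he⟩ := (D.isJordanBlock i).exists_cyclic
  refine ⟨e, e.2, fun u hu => ?_⟩
  obtain ⟨f, hf⟩ := he ⟨u, hu⟩
  refine ⟨f, ?_⟩
  have := map_aeval_of_conj (S := L.restrict (D.invariant i)) (T := L) (D.block i).subtype
    (fun _ => rfl) f e
  rw [← hf] at this
  exact this

theorem span_range_wedge (V : Type*) [AddCommGroup V] [Module ℝ V] :
    Submodule.span ℝ {x : ⋀[ℝ]^2 V | ∃ u v : V, x = wedge u v} = ⊤ := by
  rw [← exteriorPower.ιMulti_span ℝ 2 V]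
  congr 1
  ext x
  constructor
  · rintro ⟨u, v, rfl⟩
    exact ⟨![u, v], rfl⟩
  · rintro ⟨a, rfl⟩
    refine ⟨a 0, a 1, ?_⟩
    rw [wedge]
    congr 1
    ext i
    fin_cases i <;> rfl

/-- A Lie subalgebra that is the image of a single formal curvature tensor is a Berger algebra. -/
theorem IsFormalCurvatureTensor.isBergerAlgebra {V : Type*} [AddCommGroup V] [Module ℝ V]
    {R : ⋀[ℝ]^2 V →ₗ[ℝ] Module.End ℝ V} (hR : IsFormalCurvatureTensor R)
    (h : LieSubalgebra ℝ (Module.End ℝ V)) (hrange : LinearMap.range R = h.toSubmodule) :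
    IsBergerAlgebra h := by
  have himage : h.toSubmodule =
      Submodule.span ℝ (R '' {x : ⋀[ℝ]^2 V | ∃ u v : V, x = wedge u v}) := by
    rw [← hrange, LinearMap.range_eq_map, ← span_range_wedge V, Submodule.map_span]
  refine le_antisymm ?_ (Submodule.span_le.mpr ?_)
  · refine himage.trans_le (Submodule.span_le.mpr ?_)
    rintro _ ⟨_, ⟨u, v, rfl⟩, rfl⟩
    exact Submodule.subset_span ⟨R, hR, hrange.le, u, v, rfl⟩
  · rintro _ ⟨R', -, hR', u, v, rfl⟩
    exact hR' ⟨_, rfl⟩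

end JordanCurvature

theorem mainTheorem2 {V : Type*} [AddCommGroup V] [Module ℝ V] [FiniteDimensional ℝ V]
    (g : LinearMap.BilinForm ℝ V) (hg : g.Nondegenerate) (hs : g.IsSymm)
    (L : Module.End ℝ V) (hL : ∀ u v : V, g (L v) u = g v (L u)) :
    (∃ k : ℕ, Nonempty (JordanCurvature.JordanDecomposition g L k)) ∧
    (∀ (k : ℕ) (D : JordanCurvature.JordanDecomposition g L k),
      JordanCurvature.IsFormalCurvatureTensor
        (D.rFormal ∘ₗ (JordanCurvature.wedgeEquivSo g hg hs).toLinearMap) ∧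
      LinearMap.range (D.rFormal ∘ₗ (JordanCurvature.wedgeEquivSo g hg hs).toLinearMap) =
        (JordanCurvature.centraliserSo g L).toSubmodule) ∧
    JordanCurvature.IsBergerAlgebra (JordanCurvature.centraliserSo g L) := by
  have hmain : ∀ (k : ℕ) (D : JordanCurvature.JordanDecomposition g L k),
      JordanCurvature.IsFormalCurvatureTensor
        (D.rFormal ∘ₗ (JordanCurvature.wedgeEquivSo g hg hs).toLinearMap) ∧
      LinearMap.range (D.rFormal ∘ₗ (JordanCurvature.wedgeEquivSo g hg hs).toLinearMap) =
        (JordanCurvature.centraliserSo g L).toSubmodule := by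
    intro k D
    constructor
    · intro u v w
      change D.rFormal (JordanCurvature.wedgeToSo g hs _) w +
        D.rFormal (JordanCurvature.wedgeToSo g hs _) u +
        D.rFormal (JordanCurvature.wedgeToSo g hs _) v = 0
      simp only [D.rFormal_apply, LinearMap.sum_apply, ← Finset.sum_add_distrib]
      exact Finset.sum_eq_zero fun i _ => Finset.sum_eq_zero fun j _ =>
        D.rHat_bianchi hs hL i j u v w
    · rw [LinearMap.range_comp_of_range_eq_top _ (LinearEquiv.range _)]
      exact D.range_rFormal hg hs hL D.exists_cyclic
  obtain ⟨k, ⟨D⟩⟩ := JordanCurvature.exists_jordanDecomposition hg hs hL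
  exact ⟨⟨k, ⟨D⟩⟩, hmain, (hmain k D).1.isBergerAlgebra _ (hmain k D).2⟩
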